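/- **Setting.** Systems are labels $A$ with Hilbert spaces $\mathbb C^{d_A}$, $2\le d_A<\infty$ (there are infinitely many labels of every dimension); tensor factors are identified by their labels, and the standard bases are used for Choi operators. An elementary type is a finite set $s$ of distinct systems, with Hilbert space $\bigotimes_{A\in s}\mathbb C^{d_A}$; $I=\emptyset$ is the trivial type. Types are generated from the elementary types by $(x,y)\mapsto (x\to y)$. $\mathsf{Ele}_x$ is the set of systems occurring in $x$, and no system occurs twice in a type. Put $\overline x:=x\to I$ and $x\otimes y:=\overline{x\to\overline y}$, with $\bigotimes_{i=1}^n x_i:=x_1\otimes(x_2\otimes(\cdots\otimes x_n))$ (equal to $I$ for $n=0$). The extension by an elementary type $E$ of fresh systems is $s\|E:=s\cup E$, $(x\to y)\|E:=x\to(y\|E)$. For operators $R$ on the systems $\mathsf S$ and $T$ on the systems $\mathsf S'$, with $\mathsf H=\mathsf S\cap \mathsf S'$, the link product is $R*T=\operatorname{Tr}_{\mathsf H}[(R\otimes I)(I\otimes T^{\theta_{\mathsf H}})]$, where $\theta_{\mathsf H}$ is the partial transposition on $\mathsf H$. If $M$ is the Choi operator of $\mathcal M$, then $(\mathcal M\otimes\mathcal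 I_E)(R)=M*R$. *Admissible maps $\mathsf T(x)$ and deterministic maps $\mathsf T_1(x)$*, operators on $\bigotimes_{A\in\mathsf{Ele}_x}\mathbb C^{d_A}$, are defined recursively. For an elementary type, $\mathsf T_1(s)=\{M\ge0,\ \operatorname{Tr}M=1\}$ and $\mathsf T(s)=\{M\ge 0:\ M\le N\text{ for some }N\in\mathsf T_1(s)\}$. For $x\to y$: $M\in\mathsf T(x\to y)$ iff (i) for every elementary $E$ of fresh systems, $\mathcal M\otimes\mathcal I_E$ sends $\mathsf T(x\|E)$ into $\mathsf T(y\|E)$, and (ii) there are finitely many $N_1,\dots,N_n$ ($n\ge0$) satisfying (i) such that $(\mathcal M+\sum_i\mathcal N_i)\otimes\mathcal I_E$ sends $\mathsf T_1(x\|E)$ into $\mathsf T_1(y\|E)$ for every such $E$. Moreover $M\in\mathsf T_1(x\to y)$ iff $M\in\mathsf T(x\to y)$ and $\mathcal M\otimes\mathcal I_E$ sends $\mathsf T_1(x\|E)$ into $\mathsf T_1(y\|E)$ for every such $E$. Write $x\subseteq y$ if $\mathsf T(x)\subseteq\mathsf T(y)$ (so in particular $\mathsf{Ele}_x=\mathsf{Ele}_y$).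 Let $K_x(A)$ be the number modulo $2$ of arrows and open brackets to the right of $A$ in the fully bracketed expression of $x$ (elementary types are written without brackets); $\mathsf{in}_x=\{A\in\mathsf{Ele}_x:K_x(A)=1\}$ and $\mathsf{out}_x=\mathsf{Ele}_x\setminus\mathsf{in}_x$. For systems $A\neq B$ in $\mathsf{Ele}_x$ with $d_A=d_B$ let $\Phi_{AB}=\sum_{i,j}|ii\rangle\langle jj|$ on $A,B$ and $\mathcal C_{AB}(R)=R*\Phi_{AB}$. For a list $\mathsf H=((A_i,A_i'))_{i=1}^n$ of mutually disjoint pairs of this kind let $\mathcal C_{\mathsf H}(R)=\mathcal C_{A_1A_1'}(\cdots\mathcal C_{A_nA_n'}(R)\cdots)$. The contraction $\mathcal C_{\mathsf H}(x)$ is *admissible* if for every $R\in\mathsf T_1(x)$ there is a type $z$ with $\mathcal C_{\mathsf H}(R)\in\mathsf T_1(z)$; likewise for $\mathcal C_{AB}(x)$. **Statement.** Let $x$ be a type. (1) Let $\mathsf H=((A_i,A'_i))_{i=1}^n$ be a list of mutually disjoint pairs with $A_i\in\mathsf{in}_x$, $A'_i\in\mathsf{out}_x$ and $d_{A_i}=d_{A'_i}$,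 and let $\widetilde{\mathsf{in}}=\mathsf{in}_x\setminus\{A_1,\dots,A_n\}$, $\widetilde{\mathsf{out}}=\mathsf{out}_x\setminus\{A'_1,\dots,A'_n\}$, both regarded as elementary types. Then $$\mathcal C_{\mathsf H}(x)\text{ is admissible}\iff x\subseteq\Big(\bigotimes_{i=1}^n(A'_i\to A_i)\Big)\to(\widetilde{\mathsf{in}}\to\widetilde{\mathsf{out}}).$$ (2) In particular, if $A\in\mathsf{in}_x$, $B\in\mathsf{out}_x$ and $d_A=d_B$, then $$\mathcal C_{AB}(x)\text{ is admissible}\iff x\subseteq(B\to A)\to\big((\mathsf{in}_x\setminus\{A\})\to(\mathsf{out}_x\setminus\{B\})\big).$$ -/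

import Mathlib

open scoped ComplexOrder

noncomputable section

namespace HOQT

/-! ### Quantum systems and operators on finite collections of systems -/

/-- A label of a non-trivial finite dimensional quantum system. There are infinitely many distinct
labels for each dimension `≥ 2`: the first entry fixes the dimension, the second one numbers the
copies of the system of that dimension. -/
abbrev Sys : Type := ℕ × ℕ

/-- The dimension of a (non-trivial) system. -/
abbrev Sys.dim (A : Sys) : ℕ := A.1 + 2

/-- The labels of the computational basis of `⨂ i ∈ S, ℂ ^ dim i`. As the tensor factors are
identified by their labels, their order is immaterial. -/
abbrev Config (S : Finset Sys) : Type := (i : S) → Fin (Sys.dim i)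

/-- The linear operators on `⨂ i ∈ S, ℂ ^ dim i`. -/
abbrev Mat (S : Finset Sys) : Type := Matrix (Config S) (Config S) ℂ

/-- An operator together with the finite set of systems on which it acts. -/
structure Op where
  sys : Finset Sys
  mat : Mat sys

/-- The basis label on `W` that agrees with `c` on `U` and with `a` on the rest. -/
def glue {U V : Finset Sys} (W : Finset Sys) (h : W ⊆ U ∪ V) (c : Config U) (a : Config V) :
    Config W := fun i =>
  if hi : (i : Sys) ∈ U then c ⟨i, hi⟩
  else a ⟨i, (Finset.mem_union.mp (h i.2)).resolve_left hi⟩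

theorem subset_glue_left (S T : Finset Sys) : S ⊆ symmDiff S T ∪ (S ∩ T) := by
  intro i hi
  by_cases h : i ∈ T <;> simp [Finset.mem_symmDiff, hi, h]

theorem subset_glue_right (S T : Finset Sys) : T ⊆ symmDiff S T ∪ (S ∩ T) := by
  intro i hi
  by_cases h : i ∈ S <;> simp [Finset.mem_symmDiff, hi, h]

/-- The link product `R * T = Tr_H [(R ⊗ I) (I ⊗ T^θ_H)]`, where `H = R.sys ∩ T.sys` and `θ_H` is
the partial transposition on `H`. In coordinates, with `c, c'` basis labels of the systems which
are not shared and `a, a'` basis labels of the shared ones,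
`(R * T)_{c,c'} = ∑_{a,a'} R_{(c,a),(c',a')} T_{(c,a),(c',a')}`. -/
def link (R T : Op) : Op where
  sys := symmDiff R.sys T.sys
  mat := fun c c' => ∑ a : Config (R.sys ∩ T.sys), ∑ a' : Config (R.sys ∩ T.sys),
    R.mat (glue R.sys (subset_glue_left _ _) c a) (glue R.sys (subset_glue_left _ _) c' a') *
    T.mat (glue T.sys (subset_glue_right _ _) c a) (glue T.sys (subset_glue_right _ _) c' a')

/-- The operator `Φ_{AB} = ∑ i j, |i i⟩⟨j j|` on the systems `A` and `B`. -/
def Phi (A B : Sys) : Op where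
  sys := {A, B}
  mat := fun c c' =>
    if (c ⟨A, by simp⟩ : ℕ) = c ⟨B, by simp⟩ ∧ (c' ⟨A, by simp⟩ : ℕ) = c' ⟨B, by simp⟩
    then 1 else 0

/-- The contraction `C_{AB}(R) = R * Φ_{AB}`. -/
def contract (A B : Sys) (R : Op) : Op := link R (Phi A B)

/-- The multiple contraction `C_{A₁A'₁}(C_{A₂A'₂}(⋯ C_{AₙA'ₙ}(R) ⋯))`. -/
def multiContract (H : List (Sys × Sys)) (R : Op) : Op :=
  H.foldr (fun p Q => contract p.1 p.2 Q) R

/-! ### Types -/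

/-- Types of higher order maps. An elementary type is a composite of finitely many distinct
non-trivial systems; the empty composite is the trivial (one dimensional) system. -/
inductive HType : Type
  | elem (s : Finset Sys) : HType
  | arrow (x y : HType) : HType

namespace HType

/-- The trivial type `I`. -/
def triv : HType := elem ∅

/-- `Ele_x`: the non-trivial elementary systems that occur in the expression of a type. -/
def ele : HType → Finset Sys
  | elem s => s
  | arrow x y => x.ele ∪ y.ele

/-- No label of a non-trivial system occurs twice in the expression of the type. -/
def NoRepeat : HType → Prop
  | elem _ => True
  | arrow x y => x.NoRepeat ∧ y.NoRepeat ∧ Disjoint x.ele y.ele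

/-- The functional type `x → I`. -/
def bar (x : HType) : HType := arrow x triv

/-- The tensor product `x ⊗ y`, i.e. the functionals on the type `x → (y → I)`. -/
def tensor (x y : HType) : HType := bar (arrow x (bar y))

/-- `x₁ ⊗ (x₂ ⊗ (⋯ ⊗ xₙ))`; the empty tensor product is the trivial type. -/
def bigTensor : List HType → HType
  | [] => triv
  | [x] => x
  | x :: y :: l => tensor x (bigTensor (y :: l))

/-- The extension `x || E` of a type by an elementary type. -/
def ext : HType → Finset Sys → HType
  | elem s, E => elem (s ∪ E)
  | arrow x y, E => arrow x (y.ext E)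

/-- The number of arrows in a type. -/
def size : HType → ℕ
  | elem _ => 0
  | arrow x y => x.size + y.size + 1

theorem size_ext (x : HType) (E : Finset Sys) : (x.ext E).size = x.size := by
  induction x with
  | elem s => rfl
  | arrow x y _ ihy => simp [ext, size, ihy]

end HType

/-- The symbols in the string expression of a type. -/
inductive Token : Type
  | lpar : Token
  | rpar : Token
  | arr : Token
  | sys (s : Finset Sys) : Token

/-- The symbol is an elementary type that contains the system `A`. -/
def Token.isSys (A : Sys) : Token → Bool
  | sys s => decide (A ∈ s)
  | _ => false

/-- The symbol is an arrow or an open round bracket. -/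
def Token.isArrOrLpar : Token → Bool
  | arr => true
  | lpar => true
  | _ => false

namespace HType

/-- The string expression of a type. -/
def tokens : HType → List Token
  | elem s => [Token.sys s]
  | arrow x y => [Token.lpar] ++ x.tokens ++ [Token.arr] ++ y.tokens ++ [Token.rpar]

/-- `K_x(A)`: the number, modulo 2, of the arrows and the open round brackets to the right of `A`
in the expression of `x`. -/
def K (x : HType) (A : Sys) : ℕ :=
  (x.tokens.dropWhile (fun t => !(t.isSys A))).countP Token.isArrOrLpar % 2

/-- The input systems of a type. -/
def ins (x : HType) : Finset Sys := x.ele.filter (fun A => x.K A = 1)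

/-- The output systems of a type. -/
def outs (x : HType) : Finset Sys := x.ele \ x.ins

end HType

/-! ### Admissible and deterministic maps -/

/-- `M` is the Choi operator, on the systems `S`, of a linear map `𝓜`; the condition says that, for
every elementary type `E` made of fresh systems, `𝓜 ⊗ id_E` sends `X E` into `Y E`. In terms of
Choi operators, `𝓜 ⊗ id_E` acts as the link product with `M`, since
`𝓜(ρ) = Tr_in [(ρ^θ ⊗ I) M]`. -/
def ExtMapsTo (S : Finset Sys) (X Y : Finset Sys → Set Op) (M : Mat S) : Prop :=
  ∀ E : Finset Sys, Disjoint E S → ∀ R ∈ X E, link ⟨S, M⟩ R ∈ Y E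

/-- A pair of sets of operators: the admissible maps and the deterministic maps of a type. -/
structure MapSets where
  adm : Set Op
  det : Set Op

/-- The admissible and the deterministic maps of a type, by recursion on the type.

* Elementary type: the deterministic maps are the density matrices; `M ≥ 0` is admissible if
  `M ≤ N` for a deterministic `N`.
* Type `x → y`: `M` is admissible if (i) for all elementary types `E` the map `𝓜 ⊗ id_E` sends
  admissible maps of type `x || E` to admissible maps of type `y || E`, and (ii) there are finitely
  many `N₁, …, Nₙ` which satisfy (i) such that `(𝓜 + ∑ 𝓝ᵢ) ⊗ id_E` sends deterministic maps of type
  `x || E` to deterministic maps of type `y || E`, for all `E`.  `M` is deterministic if it is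
  admissible and `𝓜 ⊗ id_E` sends deterministic maps of type `x || E` to deterministic maps of type
  `y || E`, for all `E`. -/
def mapSets : HType → MapSets
  | .elem s =>
    { adm := {Q | ∃ M : Mat s, Q = ⟨s, M⟩ ∧ M.PosSemidef ∧
        ∃ N : Mat s, N.PosSemidef ∧ N.trace = 1 ∧ (N - M).PosSemidef}
      det := {Q | ∃ M : Mat s, Q = ⟨s, M⟩ ∧ M.PosSemidef ∧ M.trace = 1} }
  | .arrow x y =>
    let S : Finset Sys := x.ele ∪ y.ele
    let SendsAdm : Mat S → Prop :=
      ExtMapsTo S (fun E => (mapSets (x.ext E)).adm) (fun E => (mapSets (y.ext E)).adm)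
    let SendsDet : Mat S → Prop :=
      ExtMapsTo S (fun E => (mapSets (x.ext E)).det) (fun E => (mapSets (y.ext E)).det)
    let IsAdm : Mat S → Prop := fun M =>
      SendsAdm M ∧
        ∃ (n : ℕ) (N : Fin n → Mat S), (∀ i, SendsAdm (N i)) ∧ SendsDet (M + ∑ i, N i)
    { adm := {Q | ∃ M : Mat S, Q = ⟨S, M⟩ ∧ IsAdm M}
      det := {Q | ∃ M : Mat S, Q = ⟨S, M⟩ ∧ IsAdm M ∧ SendsDet M} }
termination_by x => x.size
decreasing_by all_goals (simp only [HType.size_ext, HType.size]; omega)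

/-- The set of admissible maps of type `x`. -/
def AdmMaps (x : HType) : Set Op := (mapSets x).adm

/-- The set of deterministic maps of type `x`. -/
def DetMaps (x : HType) : Set Op := (mapSets x).det

/-- Inclusion of types: every admissible map of type `x` is an admissible map of type `y`. -/
def HType.Included (x y : HType) : Prop := AdmMaps x ⊆ AdmMaps y

/-- The contraction of `A` and `B` in `x` is admissible. -/
def ContractionAdmissible (A B : Sys) (x : HType) : Prop :=
  ∀ R ∈ DetMaps x, ∃ z : HType, z.NoRepeat ∧ contract A B R ∈ DetMaps z

/-- The multiple contraction over `H` in `x` is admissible. -/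
def MultiContractionAdmissible (H : List (Sys × Sys)) (x : HType) : Prop :=
  ∀ R ∈ DetMaps x, ∃ z : HType, z.NoRepeat ∧ multiContract H R ∈ DetMaps z

end HOQT

end

open HOQT

noncomputable section

namespace HOQT

-- Expand every operator in a product basis whose first element, on each system, is the normalised
-- identity, and call the set of systems where a component differs from the identity its support.
-- The basis is obtained by a real symmetric orthogonal transformation of the matrix units. The link
-- product pairs entries bilinearly over the shared systems, so it keeps its form (`hat_link`), and
-- so does a contraction (`hat_Phi`).
--
-- In these coordinates the deterministic maps of type `x` are the positive operators whose identity
-- component is `x.scale` and whose other nonzero components have a support satisfying `x.DetSupp`;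
-- the admissible maps are the positive operators below them (`mem_maps_iff`). The ancillas in the
-- recursive definition serve to force positivity of the Choi operator; the affine conditions
-- already follow without ancilla, because the maximally mixed map can be perturbed in every allowed
-- Hermitian direction. For types with the same systems and the same scale, inclusion becomes
-- inclusion of the families of allowed supports (`included_iff`).
--
-- Both sides of the equivalence are then compared with `Causal`: every allowed support that
-- contains both or neither member of each pair meets the remaining outputs. For the inclusion, a
-- support is empty or allowed for the tensor product of the channels exactly when `A'_i ∈ b`
-- implies `A_i ∈ b`. This asks more than `Causal`, but deleting inputs keeps a support allowed
-- (`DetSupp.mono`), which closes the gap.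
--
-- If `Causal` holds, the contraction of a deterministic map is a channel from the remaining inputs
-- to the remaining outputs. Conversely, contract a deterministic map with all allowed components
-- equal to some `ε > 0`. Nothing cancels, so any type `z` of the result must have all remaining
-- outputs among its outputs. A support violating `Causal` either gives `z` a further output, which
-- makes `z.scale` smaller than the identity component, or adds `ε` to that component; both are
-- impossible.

-- Matrix entries indexed by labels of all systems, and the link product as a sum.

/-- A family of pairs of basis labels, one pair for each system: a label of the matrix entries of
operators on all systems simultaneously. -/
abbrev PairConf : Type := (i : Sys) → Fin i.dim × Fin i.dim

/-- The pairs of basis labels of the systems in `S`. -/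
abbrev PairOn (S : Finset Sys) : Type := (i : S) → Fin (Sys.dim i) × Fin (Sys.dim i)

/-- The matrix entry of an operator with a given label; only the systems of the operator matter. -/
def Op.ev (Q : Op) (f : PairConf) : ℂ := Q.mat (fun i => (f i).1) (fun i => (f i).2)

theorem Op.ev_congr (Q : Op) {f g : PairConf} (h : ∀ i ∈ Q.sys, f i = g i) : Q.ev f = Q.ev g := by
  unfold Op.ev
  congr 1 <;> funext i <;> rw [h i i.2]

/-- Overwrite a label on the systems in `S`. -/
def put {S : Finset Sys} (a : PairOn S) (f : PairConf) : PairConf :=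
  fun i => if h : i ∈ S then a ⟨i, h⟩ else f i

theorem put_mem {S : Finset Sys} (a : PairOn S) (f : PairConf) {i : Sys} (h : i ∈ S) :
    put a f i = a ⟨i, h⟩ := dif_pos h

theorem put_notMem {S : Finset Sys} (a : PairOn S) (f : PairConf) {i : Sys} (h : i ∉ S) :
    put a f i = f i := dif_neg h

/-- A label which is given on `S` and zero elsewhere. -/
def extend {S : Finset Sys} (c c' : Config S) : PairConf :=
  put (S := S) (fun i => (c i, c' i)) 0

theorem Op.ev_extend (Q : Op) (c c' : Config Q.sys) : Q.ev (extend c c') = Q.mat c c' := by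
  unfold Op.ev extend
  congr 1 <;> funext i <;> rw [put_mem _ _ i.2]

theorem Op.ext_ev {Q R : Op} (h : Q.sys = R.sys) (hev : ∀ f, Q.ev f = R.ev f) : Q = R := by
  obtain ⟨S, M⟩ := Q
  obtain ⟨S', N⟩ := R
  obtain rfl : S = S' := h
  congr 1
  ext c c'
  simpa only [Op.ev_extend] using hev (extend c c')

/-- A pair of families of labels is a family of pairs of labels. -/
def pairEquiv (S : Finset Sys) : Config S × Config S ≃ PairOn S where
  toFun c := fun i => (c.1 i, c.2 i)
  invFun p := (fun i => (p i).1, fun i => (p i).2)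
  left_inv _ := rfl
  right_inv _ := rfl

theorem sum_pairOn {S : Finset Sys} (F : Config S → Config S → ℂ) :
    ∑ c, ∑ c', F c c' = ∑ a : PairOn S, F (fun i => (a i).1) (fun i => (a i).2) := by
  rw [← Fintype.sum_prod_type', ← (pairEquiv S).sum_comp]
  rfl

/-- With entries indexed by labels of all systems at once, the link product is a bilinear pairing
over the shared labels, the form in which its invariance under orthogonal changes of basis is
visible. -/
theorem link_ev (R T : Op) {H : Finset Sys} (hH : R.sys ∩ T.sys = H) (f : PairConf) :
    (link R T).ev f = ∑ a : PairOn H, R.ev (put a f) * T.ev (put a f) := by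
  subst hH
  unfold Op.ev link
  simp only
  rw [sum_pairOn]
  refine Finset.sum_congr rfl fun a _ => ?_
  have key : ∀ (W : Finset Sys) (hW : W ⊆ symmDiff R.sys T.sys ∪ (R.sys ∩ T.sys)),
      (glue W hW (fun i => (f i).1) (fun i => (a i).1) = fun i : W => (put a f i).1) ∧
      (glue W hW (fun i => (f i).2) (fun i => (a i).2) = fun i : W => (put a f i).2) := by
    intro W hW
    constructor <;> funext i
    all_goals
      by_cases hi : (i : Sys) ∈ symmDiff R.sys T.sys
      · have : (i : Sys) ∉ R.sys ∩ T.sys := by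
          simp only [Finset.mem_symmDiff] at hi
          simp only [Finset.mem_inter]
          tauto
        simp [glue, hi, put_notMem _ _ this]
      · have : (i : Sys) ∈ R.sys ∩ T.sys := (Finset.mem_union.mp (hW i.2)).resolve_left hi
        simp [glue, hi, put_mem _ _ this]
  rw [(key _ _).1, (key _ _).2, (key _ _).1, (key _ _).2]

/-- The labels of a disjoint union. -/
def unionEquiv {U V W : Finset Sys} (hW : U ∪ V = W) (hd : Disjoint U V) :
    PairOn U × PairOn V ≃ PairOn W where
  toFun p i := if h : (i : Sys) ∈ U then p.1 ⟨i, h⟩ else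
    p.2 ⟨i, (Finset.mem_union.mp (hW ▸ i.2)).resolve_left h⟩
  invFun q := (fun i => q ⟨i, hW ▸ Finset.mem_union_left _ i.2⟩,
    fun i => q ⟨i, hW ▸ Finset.mem_union_right _ i.2⟩)
  left_inv p := by
    ext i
    · simp
    · simp
    · simp [Finset.disjoint_right.mp hd i.2]
    · simp [Finset.disjoint_right.mp hd i.2]
  right_inv q := by
    funext i
    by_cases h : (i : Sys) ∈ U <;> simp [h]

theorem sum_put_union {U V W : Finset Sys} (hW : U ∪ V = W) (hd : Disjoint U V)
    (F : PairConf → ℂ) (f : PairConf) :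
    ∑ a : PairOn W, F (put a f) = ∑ u : PairOn U, ∑ v : PairOn V, F (put u (put v f)) := by
  rw [← Fintype.sum_prod_type', ← (unionEquiv hW hd).sum_comp]
  refine Finset.sum_congr rfl fun p _ => congrArg F ?_
  funext i
  subst hW
  by_cases hU : i ∈ U
  · simp [put, unionEquiv, hU]
  · by_cases hV : i ∈ V <;> simp [put, unionEquiv, hU, hV]

theorem sum_put_eq_single {S : Finset Sys} (f : PairConf) (F : PairConf → ℂ) (g : PairConf)
    (hF : ∀ a : PairOn S, (∃ i : S, a i ≠ g i) → F (put a f) = 0) :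
    ∑ a : PairOn S, F (put a f) = F (put (S := S) (fun i => g i) f) := by
  rw [Finset.sum_eq_single (fun i : S => g i)]
  · intro a _ ha
    exact hF a (Function.ne_iff.mp ha)
  · simp

-- A real orthogonal change of basis adapted to the identity.

/-- `1 / √d`. -/
def invSqrt (d : ℕ) : ℝ := (√(d : ℝ))⁻¹

theorem invSqrt_pos {d : ℕ} (hd : 0 < d) : 0 < invSqrt d := by
  unfold invSqrt
  positivity

theorem invSqrt_sq {d : ℕ} : invSqrt d ^ 2 = (d : ℝ)⁻¹ := by
  rw [invSqrt, inv_pow, Real.sq_sqrt (Nat.cast_nonneg d)]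

theorem invSqrt_lt_one {d : ℕ} (hd : 2 ≤ d) : invSqrt d < 1 := by
  have h : (2 : ℝ) ≤ d := by exact_mod_cast hd
  apply inv_lt_one_of_one_lt₀
  rw [Real.lt_sqrt zero_le_one]
  linarith

/-- The difference between the matrix unit `E₀₀` and the normalised identity matrix. -/
def mixVec (d : ℕ) [NeZero d] (p : Fin d × Fin d) : ℝ :=
  (if p = 0 then 1 else 0) - (if p.1 = p.2 then invSqrt d else 0)

/-- The matrix of the reflection on the space of `d × d` matrices which exchanges the matrix unit
`E₀₀` and the normalised identity matrix. -/
def mix (d : ℕ) [NeZero d] (p q : Fin d × Fin d) : ℝ :=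
  (if p = q then 1 else 0) - mixVec d p * mixVec d q / (1 - invSqrt d)

theorem mixVec_zero (d : ℕ) [NeZero d] : mixVec d 0 = 1 - invSqrt d := by
  simp [mixVec]

theorem sum_mixVec_sq (d : ℕ) [NeZero d] : ∑ p, mixVec d p * mixVec d p = 2 * (1 - invSqrt d) := by
  have h : ∀ p : Fin d × Fin d, mixVec d p * mixVec d p =
      (if p = 0 then 1 - 2 * invSqrt d else 0) + (if p.1 = p.2 then invSqrt d ^ 2 else 0) := by
    intro p
    unfold mixVec
    by_cases hp : p = 0
    · subst hp
      simp
      ring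
    · by_cases hq : p.1 = p.2 <;> simp [hp, hq]
      ring
  have hd : (d : ℝ) ≠ 0 := Nat.cast_ne_zero.mpr (NeZero.ne d)
  rw [Finset.sum_congr rfl fun p _ => h p, Finset.sum_add_distrib, Fintype.sum_prod_type
    (f := fun p : Fin d × Fin d => if p.1 = p.2 then invSqrt d ^ 2 else 0)]
  simp [invSqrt_sq, hd]
  ring

theorem mix_comm (d : ℕ) [NeZero d] (p q : Fin d × Fin d) : mix d p q = mix d q p := by
  unfold mix
  rw [mul_comm (mixVec d p), if_congr eq_comm rfl rfl]

/-- Both exchanged vectors are symmetric matrices, so the reflection commutes with transposition.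
Being real as well, it will preserve hermiticity. -/
theorem mix_swap (d : ℕ) [NeZero d] (p q : Fin d × Fin d) :
    mix d p.swap q.swap = mix d p q := by
  have h : ∀ p : Fin d × Fin d, mixVec d p.swap = mixVec d p := by
    intro p
    have h1 : p.swap = 0 ↔ p = 0 := by
      simp [Prod.ext_iff, and_comm]
    have h2 : p.swap.1 = p.swap.2 ↔ p.1 = p.2 := eq_comm
    simp only [mixVec, h1, h2]
  unfold mix
  rw [h, h]
  simp only [Prod.swap_inj]

theorem mix_zero {d : ℕ} [NeZero d] (hd : 2 ≤ d) (q : Fin d × Fin d) :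
    mix d 0 q = if q.1 = q.2 then invSqrt d else 0 := by
  have h : 1 - invSqrt d ≠ 0 := by linarith [invSqrt_lt_one hd]
  rw [mix, mixVec_zero, mul_div_assoc, mul_div_cancel₀ _ h, mixVec]
  simp only [eq_comm (a := (0 : Fin d × Fin d))]
  ring

/-- This is a Householder reflection: `mixVec` has squared norm `2 * (1 - invSqrt d)`, so
subtracting its rank one projector twice is orthogonal. The bound `2 ≤ d` keeps the denominator
nonzero. -/
theorem sum_mix_mul_mix {d : ℕ} [NeZero d] (hd : 2 ≤ d) (p q : Fin d × Fin d) :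
    ∑ r, mix d r p * mix d r q = if p = q then 1 else 0 := by
  have h : 1 - invSqrt d ≠ 0 := by linarith [invSqrt_lt_one hd]
  have key : ∀ r, mix d r p * mix d r q = (if r = p then (if p = q then 1 else 0) else 0)
      - (if r = p then mixVec d p * mixVec d q / (1 - invSqrt d) else 0)
      - (if r = q then mixVec d p * mixVec d q / (1 - invSqrt d) else 0)
      + mixVec d r * mixVec d r * (mixVec d p * mixVec d q / (1 - invSqrt d) ^ 2) := by
    intro r
    unfold mix
    by_cases h1 : r = p
    · subst h1
      by_cases h2 : r = q
      · subst h2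
        simp
        field_simp
        ring
      · simp [h2]
        field_simp
        ring
    · by_cases h2 : r = q
      · subst h2
        simp [h1]
        field_simp
        ring
      · simp [h1, h2]
        field_simp
  rw [Finset.sum_congr rfl fun r _ => key r, Finset.sum_add_distrib, Finset.sum_sub_distrib,
    Finset.sum_sub_distrib, ← Finset.sum_mul, sum_mixVec_sq]
  simp only [Finset.sum_ite_eq', Finset.mem_univ, if_true]
  field_simp
  ring

/-- The kernel of the change of basis on the systems in `S`. -/
def kern (S : Finset Sys) (f g : PairConf) : ℂ := ∏ i ∈ S, (mix i.dim (f i) (g i) : ℂ)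

theorem kern_congr {S : Finset Sys} {f f' g g' : PairConf} (hf : ∀ i ∈ S, f i = f' i)
    (hg : ∀ i ∈ S, g i = g' i) : kern S f g = kern S f' g' :=
  Finset.prod_congr rfl fun i hi => by rw [hf i hi, hg i hi]

theorem kern_comm (S : Finset Sys) (f g : PairConf) : kern S f g = kern S g f :=
  Finset.prod_congr rfl fun i _ => by rw [mix_comm]

theorem kern_union {U V W : Finset Sys} (hW : U ∪ V = W) (hd : Disjoint U V) (f g : PairConf) :
    kern W f g = kern U f g * kern V f g := by
  subst hW
  exact Finset.prod_union hd

theorem prod_ite_eq_one (S : Finset Sys) (P : Sys → Prop) [DecidablePred P] :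
    ∏ i ∈ S, (if P i then (1 : ℂ) else 0) = if ∀ i ∈ S, P i then 1 else 0 := by
  split_ifs with h
  · exact Finset.prod_eq_one fun i hi => if_pos (h i hi)
  · push Not at h
    obtain ⟨i, hi, hP⟩ := h
    exact Finset.prod_eq_zero hi (if_neg hP)

theorem sum_kern_mul_kern (S : Finset Sys) (f g h : PairConf) :
    ∑ a : PairOn S, kern S (put a f) g * kern S (put a f) h =
      if ∀ i ∈ S, g i = h i then 1 else 0 := by
  have : ∀ a : PairOn S, kern S (put a f) g * kern S (put a f) h =
      ∏ i : S, ((mix (Sys.dim i) (a i) (g i) * mix (Sys.dim i) (a i) (h i) : ℝ) : ℂ) := by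
    intro a
    unfold kern
    rw [← Finset.prod_mul_distrib, ← Finset.prod_coe_sort S]
    refine Finset.prod_congr rfl fun i _ => ?_
    rw [put_mem _ _ i.2]
    push_cast
    rfl
  rw [Finset.sum_congr rfl fun a _ => this a, ← Fintype.prod_sum
    (f := fun (i : S) (p : Fin (Sys.dim i) × Fin (Sys.dim i)) =>
      ((mix (Sys.dim i) p (g i) * mix (Sys.dim i) p (h i) : ℝ) : ℂ)), ← prod_ite_eq_one,
    ← Finset.prod_coe_sort S]
  refine Finset.prod_congr rfl fun i _ => ?_
  rw [← Complex.ofReal_sum, sum_mix_mul_mix (Nat.le_add_left 2 _)]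
  split_ifs <;> simp

/-- The operator in the product basis whose first element, for each system, is the normalised
identity. -/
def hat (Q : Op) : Op where
  sys := Q.sys
  mat := fun c c' => ∑ a : PairOn Q.sys,
    kern Q.sys (extend c c') (put a 0) * Q.ev (put a 0)

theorem hat_ev (Q : Op) (f : PairConf) :
    (hat Q).ev f = ∑ a : PairOn Q.sys, kern Q.sys f (put a f) * Q.ev (put a f) := by
  refine Finset.sum_congr rfl fun a _ => ?_
  congr 1
  · refine kern_congr (fun i hi => ?_) fun i hi => ?_
    · simp [extend, put_mem _ _ hi]
    · rw [put_mem _ _ hi, put_mem _ _ hi]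
  · exact Q.ev_congr fun i hi => by rw [put_mem _ _ hi, put_mem _ _ hi]

theorem hat_ev' (Q : Op) {S : Finset Sys} (hS : Q.sys = S) (f : PairConf) :
    (hat Q).ev f = ∑ a : PairOn S, kern S f (put a f) * Q.ev (put a f) := by
  subst hS
  exact hat_ev Q f

theorem put_put {S : Finset Sys} (a b : PairOn S) (f : PairConf) :
    put a (put b f) = put a f := by
  funext i
  by_cases h : i ∈ S <;> simp [put, h]

theorem put_self {S : Finset Sys} (f : PairConf) : put (S := S) (fun i => f i) f = f := by
  funext i
  by_cases h : i ∈ S <;> simp [put, h]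

/-- The kernel is symmetric and orthogonal, hence an involution. Thus `hat` also serves to build an
operator with prescribed components. -/
theorem hat_hat (Q : Op) : hat (hat Q) = Q := by
  refine Op.ext_ev rfl fun f => ?_
  rw [hat_ev]
  change ∑ a : PairOn Q.sys, kern Q.sys f (put a f) * (hat Q).ev (put a f) = _
  simp only [hat_ev, put_put, Finset.mul_sum]
  rw [Finset.sum_comm]
  have : ∀ b : PairOn Q.sys, ∑ a : PairOn Q.sys,
      kern Q.sys f (put a f) * (kern Q.sys (put a f) (put b f) * Q.ev (put b f)) =
      (if ∀ i ∈ Q.sys, f i = put b f i then 1 else 0) * Q.ev (put b f) := by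
    intro b
    rw [← sum_kern_mul_kern Q.sys f, Finset.sum_mul]
    refine Finset.sum_congr rfl fun a _ => ?_
    rw [kern_comm _ f, mul_assoc]
  rw [Finset.sum_congr rfl fun b _ => this b, sum_put_eq_single f
    (fun g => (if ∀ i ∈ Q.sys, f i = g i then 1 else 0) * Q.ev g) f, put_self]
  · simp
  · rintro a ⟨i, hi⟩
    rw [if_neg, zero_mul]
    intro h
    apply hi
    rw [h i i.2, put_mem _ _ i.2]

/-- The change of basis is compatible with the link product. -/
theorem hat_link (R T : Op) : hat (link R T) = link (hat R) (hat T) := by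
  refine Op.ext_ev rfl fun f => ?_
  set H := R.sys ∩ T.sys with hH
  set U := R.sys \ T.sys with hU
  set V := T.sys \ R.sys with hV
  have hUV : Disjoint U V := disjoint_sdiff_sdiff
  have hUH : Disjoint U H := Finset.disjoint_sdiff_inter _ _
  have hVH : Disjoint V H := by
    rw [hH, Finset.inter_comm]
    exact Finset.disjoint_sdiff_inter _ _
  have hR : U ∪ H = R.sys := Finset.sdiff_union_inter _ _
  have hT : V ∪ H = T.sys := by
    rw [hH, Finset.inter_comm]
    exact Finset.sdiff_union_inter _ _
  have hS : U ∪ V = (link R T).sys := rfl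
  have e1 : ∀ (u : PairOn U) (v : PairOn V) (h : PairOn H),
      R.ev (put h (put u (put v f))) = R.ev (put u (put h f)) := by
    intro u v h
    refine R.ev_congr fun i hi => ?_
    by_cases h1 : i ∈ H
    · have h2 : i ∉ U := Finset.disjoint_right.mp hUH h1
      simp [put, h1, h2]
    · have h2 : i ∈ U := (Finset.mem_union.mp (hR ▸ hi)).resolve_right h1
      simp [put, h1, h2]
  have e2 : ∀ (u : PairOn U) (v : PairOn V) (h : PairOn H),
      T.ev (put h (put u (put v f))) = T.ev (put v (put h f)) := by
    intro u v h
    refine T.ev_congr fun i hi => ?_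
    by_cases h1 : i ∈ H
    · have h2 : i ∉ V := Finset.disjoint_right.mp hVH h1
      have h3 : i ∉ U := Finset.disjoint_right.mp hUH h1
      simp [put, h1, h2]
    · have h2 : i ∈ V := (Finset.mem_union.mp (hT ▸ hi)).resolve_right h1
      have h3 : i ∉ U := Finset.disjoint_right.mp hUV h2
      simp [put, h1, h2, h3]
  have k1 : ∀ (u : PairOn U) (v : PairOn V),
      kern (link R T).sys f (put u (put v f)) = kern U f (put u f) * kern V f (put v f) := by
    intro u v
    rw [kern_union hS hUV]
    congr 1
    · exact kern_congr (fun _ _ => rfl) fun i hi => by rw [put_mem _ _ hi, put_mem _ _ hi]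
    · exact kern_congr (fun _ _ => rfl) fun i hi => by
        rw [put_notMem _ _ (Finset.disjoint_right.mp hUV hi)]
  have k2 : ∀ {A W : Finset Sys} (hW : A ∪ H = W) (hd : Disjoint A H)
      (u : PairOn A) (k h : PairOn H), kern W (put k f) (put u (put h f)) =
        kern A f (put u f) * kern H (put k f) (put h f) := by
    intro A W hW hd u k h
    rw [kern_union hW hd]
    congr 1
    · exact kern_congr (fun i hi => put_notMem _ _ (Finset.disjoint_left.mp hd hi)) fun i hi => by
        rw [put_mem _ _ hi, put_mem _ _ hi]
    · exact kern_congr (fun _ _ => rfl) fun i hi =>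
        put_notMem _ _ (Finset.disjoint_right.mp hd hi)
  have hhR : ∀ k : PairOn H, (hat R).ev (put k f) = ∑ u : PairOn U, ∑ h : PairOn H,
      kern U f (put u f) * kern H (put k f) (put h f) * R.ev (put u (put h f)) := by
    intro k
    rw [hat_ev, sum_put_union hR hUH (fun g => kern R.sys (put k f) g * R.ev g)]
    simp only [put_put, k2 hR hUH]
  have hhT : ∀ k : PairOn H, (hat T).ev (put k f) = ∑ v : PairOn V, ∑ h : PairOn H,
      kern V f (put v f) * kern H (put k f) (put h f) * T.ev (put v (put h f)) := by
    intro k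
    rw [hat_ev, sum_put_union hT hVH (fun g => kern T.sys (put k f) g * T.ev g)]
    simp only [put_put, k2 hT hVH]
  -- Orthogonality on the shared systems: summing over the new label `k` forces the old labels of
  -- the two factors to agree, which restores the original pairing.
  have orth : ∀ (F : PairOn H → PairOn H → ℂ), ∑ k : PairOn H, ∑ h : PairOn H, ∑ h' : PairOn H,
      kern H (put k f) (put h f) * kern H (put k f) (put h' f) * F h h' = ∑ h, F h h := by
    intro F
    rw [Finset.sum_comm]
    refine Finset.sum_congr rfl fun h _ => ?_
    rw [Finset.sum_comm]
    simp only [← Finset.sum_mul, sum_kern_mul_kern]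
    rw [Finset.sum_eq_single h]
    · simp
    · intro h' _ hne
      rw [if_neg, zero_mul]
      intro hall
      apply hne
      funext i
      have := hall i i.2
      rw [put_mem _ _ i.2, put_mem _ _ i.2] at this
      exact this.symm
    · simp
  rw [hat_ev' _ rfl, sum_put_union hS hUV
    (fun g => kern (link R T).sys f g * (link R T).ev g), link_ev (hat R) (hat T) hH.symm]
  simp only [hhR, hhT, k1, link_ev R T hH.symm, e1, e2]
  have : ∀ k : PairOn H,
      (∑ u : PairOn U, ∑ h : PairOn H,
        kern U f (put u f) * kern H (put k f) (put h f) * R.ev (put u (put h f))) *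
      (∑ v : PairOn V, ∑ h : PairOn H,
        kern V f (put v f) * kern H (put k f) (put h f) * T.ev (put v (put h f))) =
      ∑ h : PairOn H, ∑ h' : PairOn H,
        kern H (put k f) (put h f) * kern H (put k f) (put h' f) *
          ((∑ u : PairOn U, kern U f (put u f) * R.ev (put u (put h f))) *
          (∑ v : PairOn V, kern V f (put v f) * T.ev (put v (put h' f)))) := by
    intro k
    rw [Finset.sum_comm (s := (Finset.univ : Finset (PairOn U))),
      Finset.sum_comm (s := (Finset.univ : Finset (PairOn V))),
      Finset.sum_mul_sum]
    refine Finset.sum_congr rfl fun h _ => Finset.sum_congr rfl fun h' _ => ?_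
    have a1 : ∀ u : PairOn U, kern U f (put u f) * kern H (put k f) (put h f) *
        R.ev (put u (put h f)) = kern H (put k f) (put h f) *
          (kern U f (put u f) * R.ev (put u (put h f))) := fun u => by ring
    have a2 : ∀ v : PairOn V, kern V f (put v f) * kern H (put k f) (put h' f) *
        T.ev (put v (put h' f)) = kern H (put k f) (put h' f) *
          (kern V f (put v f) * T.ev (put v (put h' f))) := fun v => by ring
    simp only [a1, a2, ← Finset.mul_sum]
    ring
  rw [Finset.sum_congr rfl fun k _ => this k, orth]
  simp only [Finset.sum_mul_sum]
  simp only [Finset.mul_sum]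
  symm
  rw [Finset.sum_comm]
  refine Finset.sum_congr rfl fun u _ => ?_
  rw [Finset.sum_comm]
  refine Finset.sum_congr rfl fun v _ => Finset.sum_congr rfl fun h _ => ?_
  ring

/-! ### Linearity -/

/-- The matrix of the link product. -/
def linkMat (R T : Op) : Mat (symmDiff R.sys T.sys) := (link R T).mat

/-- The matrix of an operator after the change of basis. -/
def hatMat {S : Finset Sys} (M : Mat S) : Mat S := (hat ⟨S, M⟩).mat

theorem linkMat_apply (R T : Op) (c c' : Config (symmDiff R.sys T.sys)) : linkMat R T c c' =
    ∑ a : Config (R.sys ∩ T.sys), ∑ a' : Config (R.sys ∩ T.sys),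
      R.mat (glue R.sys (subset_glue_left _ _) c a) (glue R.sys (subset_glue_left _ _) c' a') *
      T.mat (glue T.sys (subset_glue_right _ _) c a)
        (glue T.sys (subset_glue_right _ _) c' a') := rfl

theorem hatMat_apply {S : Finset Sys} (M : Mat S) (c c' : Config S) : hatMat M c c' =
    ∑ a : PairOn S, kern S (extend c c') (put a 0) *
      M (fun i => (put a 0 i).1) (fun i => (put a 0 i).2) := rfl

theorem linkMat_sub_left {S : Finset Sys} (M N : Mat S) (R : Op) :
    linkMat ⟨S, M - N⟩ R = linkMat ⟨S, M⟩ R - linkMat ⟨S, N⟩ R := by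
  ext c c'
  rw [Matrix.sub_apply]
  simp only [linkMat_apply, Matrix.sub_apply, sub_mul, Finset.sum_sub_distrib]

theorem linkMat_sub_right {S : Finset Sys} (R : Op) (M N : Mat S) :
    linkMat R ⟨S, M - N⟩ = linkMat R ⟨S, M⟩ - linkMat R ⟨S, N⟩ := by
  ext c c'
  rw [Matrix.sub_apply]
  simp only [linkMat_apply, Matrix.sub_apply, mul_sub, Finset.sum_sub_distrib]

theorem hatMat_add {S : Finset Sys} (M N : Mat S) : hatMat (M + N) = hatMat M + hatMat N := by
  ext c c'
  rw [Matrix.add_apply]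
  simp only [hatMat_apply, Matrix.add_apply, mul_add, Finset.sum_add_distrib]

theorem hatMat_smul {S : Finset Sys} (k : ℂ) (M : Mat S) : hatMat (k • M) = k • hatMat M := by
  ext c c'
  rw [Matrix.smul_apply]
  simp only [hatMat_apply, Matrix.smul_apply, smul_eq_mul, Finset.mul_sum, mul_left_comm]

/-! ### Positivity -/

theorem posSemidef_sum_blocks {C A : Type*} [Fintype C] [Fintype A]
    {H : Matrix (C × A) (C × A) ℂ} (hH : H.PosSemidef) :
    (Matrix.of fun c c' => ∑ a, ∑ a', H (c, a) (c', a')).PosSemidef := by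
  classical
  let B : Matrix (C × A) C ℂ := Matrix.of fun p c => if p.1 = c then 1 else 0
  convert hH.conjTranspose_mul_mul_same B using 1
  ext c c'
  simp only [Matrix.of_apply, Matrix.mul_apply, Matrix.conjTranspose_apply, B,
    Fintype.sum_prod_type]
  rw [Finset.sum_eq_single c' (fun b _ hb => by simp [hb]) (by simp), Finset.sum_comm]
  refine Finset.sum_congr rfl fun a' _ => ?_
  rw [Finset.sum_eq_single c (fun b _ hb => by simp [hb]) (by simp)]
  simp

/-- The summands form the Hadamard product of two positive matrices, positive by Schur; summing its
entries over the shared labels is a compression. -/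
theorem link_posSemidef {R T : Op} (hR : R.mat.PosSemidef) (hT : T.mat.PosSemidef) :
    (link R T).mat.PosSemidef := by
  have h := posSemidef_sum_blocks (C := Config (symmDiff R.sys T.sys))
    (A := Config (R.sys ∩ T.sys))
    ((hR.submatrix fun p => glue R.sys (subset_glue_left _ _) p.1 p.2).hadamard
      (hT.submatrix fun p => glue T.sys (subset_glue_right _ _) p.1 p.2))
  exact h

theorem isHermitian_iff_ev (Q : Op) :
    Q.mat.IsHermitian ↔ ∀ f, star (Q.ev f) = Q.ev (fun i => (f i).swap) := by
  constructor
  · intro h f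
    exact h.apply _ _
  · intro h
    ext c c'
    have := h (extend c' c)
    rw [Op.ev_extend] at this
    rw [Matrix.conjTranspose_apply, this, ← Op.ev_extend Q c c']
    exact Q.ev_congr fun i hi => by simp [extend, put_mem _ _ hi]

theorem hat_isHermitian {Q : Op} (h : Q.mat.IsHermitian) : (hat Q).mat.IsHermitian := by
  rw [isHermitian_iff_ev] at h ⊢
  intro f
  rw [hat_ev, hat_ev, star_sum]
  let e : PairOn Q.sys ≃ PairOn Q.sys := Equiv.piCongrRight fun _ => Equiv.prodComm _ _
  rw [← e.sum_comp]
  refine Finset.sum_congr rfl fun a _ => ?_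
  rw [star_mul', h]
  congr 1
  · unfold kern
    rw [star_prod]
    refine Finset.prod_congr rfl fun i hi => ?_
    rw [put_mem _ _ hi, put_mem _ _ hi]
    rw [← mix_swap]
    simp [e]
  · refine Q.ev_congr fun i hi => ?_
    rw [put_mem _ _ hi, put_mem _ _ hi]
    simp [e]

open scoped MatrixOrder Matrix.Norms.L2Operator in
theorem exists_posSemidef_add {n : Type*} [Fintype n] [DecidableEq n] {l : ℝ} (hl : 0 < l)
    {X : Matrix n n ℂ} (hX : X.IsHermitian) :
    ∃ ε : ℝ, 0 < ε ∧ ((l : ℂ) • (1 : Matrix n n ℂ) + (ε : ℂ) • X).PosSemidef := by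
  have h := IsSelfAdjoint.neg_algebraMap_norm_le_self (a := X) hX
  rw [Matrix.le_iff] at h
  have hp : 0 < 1 + ‖X‖ := by positivity
  -- Since `X ≥ -‖X‖`, any `ε` with `ε * ‖X‖ ≤ l` works; the added `1` avoids division by zero.
  refine ⟨l / (1 + ‖X‖), by positivity, ?_⟩
  have h1 : (((l / (1 + ‖X‖) : ℝ) : ℂ) • (X - -algebraMap ℝ (Matrix n n ℂ) ‖X‖)).PosSemidef :=
    h.smul (by exact_mod_cast (by positivity : 0 ≤ l / (1 + ‖X‖)))
  have h2 : (((l / (1 + ‖X‖) : ℝ) : ℂ) • (1 : Matrix n n ℂ)).PosSemidef :=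
    Matrix.PosSemidef.one.smul (by exact_mod_cast (by positivity : 0 ≤ l / (1 + ‖X‖)))
  convert h1.add h2 using 1
  have : (l : ℂ) = ((l / (1 + ‖X‖) : ℝ) : ℂ) * ‖X‖ + ((l / (1 + ‖X‖) : ℝ) : ℂ) := by
    push_cast
    have : (1 + (‖X‖ : ℂ)) ≠ 0 := by exact_mod_cast hp.ne'
    field_simp
    ring
  rw [this, Algebra.algebraMap_eq_smul_one, sub_neg_eq_add, smul_add, add_smul]
  have e : (‖X‖ : ℝ) • (1 : Matrix n n ℂ) = (‖X‖ : ℂ) • 1 := (Complex.coe_smul _ _).symm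
  rw [e, smul_smul]
  abel

/-! ### The identity and the trace -/

theorem kern_zero {S : Finset Sys} {f : PairConf} (hf : ∀ i ∈ S, f i = 0) (g : PairConf) :
    kern S f g = if ∀ i ∈ S, (g i).1 = (g i).2 then ∏ i ∈ S, (invSqrt i.dim : ℂ) else 0 := by
  rw [← Finset.prod_ite_zero]
  refine Finset.prod_congr rfl fun i hi => ?_
  rw [hf i hi, mix_zero (Nat.le_add_left 2 _)]
  split_ifs <;> simp

theorem hat_ev_zero (Q : Op) {f : PairConf} (hf : ∀ i ∈ Q.sys, f i = 0) :
    (hat Q).ev f = (∏ i ∈ Q.sys, (invSqrt i.dim : ℂ)) * Q.mat.trace := by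
  have h : ∀ a : PairOn Q.sys, kern Q.sys f (put a f) * Q.ev (put a f) =
      (if (fun i => (a i).1) = (fun i => (a i).2) then
        (∏ i ∈ Q.sys, (invSqrt i.dim : ℂ)) * Q.mat (fun i => (a i).1) (fun i => (a i).2) else 0) := by
    intro a
    have h1 : (∀ i ∈ Q.sys, (put a f i).1 = (put a f i).2) ↔
        (fun i => (a i).1) = (fun i => (a i).2) := by
      rw [funext_iff]
      exact ⟨fun h i => by simpa [put_mem _ _ i.2] using h i i.2,
        fun h i hi => by simpa [put_mem _ _ hi] using h ⟨i, hi⟩⟩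
    have h2 : Q.ev (put a f) = Q.mat (fun i => (a i).1) (fun i => (a i).2) := by
      unfold Op.ev
      congr 1 <;> funext i <;> rw [put_mem _ _ i.2]
    rw [kern_zero hf, h2]
    simp only [h1]
    split_ifs <;> simp
  rw [hat_ev, Finset.sum_congr rfl fun a _ => h a,
    ← sum_pairOn (fun c c' => if c = c' then (∏ i ∈ Q.sys, (invSqrt i.dim : ℂ)) * Q.mat c c' else 0)]
  simp [Matrix.trace, Finset.mul_sum]

/-- The operator that becomes proportional to the identity after the change of basis. -/
def vac (S : Finset Sys) : Mat S := fun c c' => if c = 0 ∧ c' = 0 then 1 else 0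

theorem vac_ev (S : Finset Sys) (f : PairConf) :
    Op.ev ⟨S, vac S⟩ f = if ∀ i ∈ S, f i = 0 then 1 else 0 := by
  unfold Op.ev vac
  refine if_congr ?_ rfl rfl
  rw [funext_iff, funext_iff]
  constructor
  · rintro ⟨h1, h2⟩ i hi
    exact Prod.ext (h1 ⟨i, hi⟩) (h2 ⟨i, hi⟩)
  · intro h
    exact ⟨fun i => by simp [h i i.2], fun i => by simp [h i i.2]⟩

theorem hatMat_vac (S : Finset Sys) :
    hatMat (vac S) = (∏ i ∈ S, (invSqrt i.dim : ℂ)) • (1 : Mat S) := by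
  have h : hat ⟨S, vac S⟩ = ⟨S, (∏ i ∈ S, (invSqrt i.dim : ℂ)) • (1 : Mat S)⟩ := by
    refine Op.ext_ev rfl fun f => ?_
    rw [hat_ev' _ rfl]
    simp only [vac_ev]
    rw [sum_put_eq_single f (fun g => kern S f g * if ∀ i ∈ S, g i = 0 then 1 else 0) 0]
    · have h0 : ∀ i ∈ S, put (S := S) (fun i => (0 : PairConf) i) f i = 0 := by
        intro i hi
        rw [put_mem _ _ hi]
        rfl
      simp only [if_pos h0]
      rw [kern_comm, kern_zero h0]
      simp only [Op.ev, Matrix.smul_apply, Matrix.one_apply, smul_eq_mul, mul_ite, mul_one, mul_zero]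
      refine if_congr ?_ rfl rfl
      rw [funext_iff]
      exact ⟨fun h i => h i i.2, fun h i hi => h ⟨i, hi⟩⟩
    · rintro a ⟨i, hi⟩
      rw [if_neg, mul_zero]
      intro h
      apply hi
      simpa [put_mem _ _ i.2] using h i i.2
  exact (Op.mk.injEq _ _ _ _ ▸ h : _ ∧ HEq _ _).2.eq

/-! ### Contractions -/

theorem sum_put_singleton (A : Sys) (F : PairConf → ℂ) (f : PairConf) :
    ∑ a : PairOn {A}, F (put a f) = ∑ p, F (Function.update f A p) := by
  refine Fintype.sum_bijective (fun a : PairOn {A} => a ⟨A, Finset.mem_singleton_self A⟩) ⟨?_, ?_⟩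
    _ _ fun a => congrArg F ?_
  · intro a b h
    funext ⟨i, hi⟩
    obtain rfl := Finset.mem_singleton.mp hi
    exact h
  · intro p
    exact ⟨fun i => Function.update (0 : PairConf) A p i, by simp⟩
  · funext i
    by_cases hi : i = A
    · subst hi
      simp [put]
    · simp [put, hi]

theorem sum_put_pair {A B : Sys} (hAB : A ≠ B) (F : PairConf → ℂ) (f : PairConf) :
    ∑ a : PairOn {A, B}, F (put a f) =
      ∑ p, ∑ q, F (Function.update (Function.update f A p) B q) := by
  have hU : ({B} : Finset Sys) ∪ {A} = {A, B} := by
    ext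
    simp [or_comm]
  have hD : Disjoint ({B} : Finset Sys) {A} := by simpa using hAB.symm
  rw [sum_put_union hU hD F, Finset.sum_comm]
  simp only [sum_put_singleton B F]
  exact sum_put_singleton A (fun g => ∑ q, F (Function.update g B q)) f

theorem Phi_ev (A B : Sys) (f : PairConf) : (Phi A B).ev f =
    if ((f A).1 : ℕ) = (f B).1 ∧ ((f A).2 : ℕ) = (f B).2 then 1 else 0 := rfl

theorem Phi_ev_update {A B : Sys} (hAB : A ≠ B) (hd : A.dim = B.dim) (f : PairConf)
    (p : Fin A.dim × Fin A.dim) (q : Fin B.dim × Fin B.dim) :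
    (Phi A B).ev (Function.update (Function.update f A p) B q) =
      if q = Prod.map (Fin.cast hd) (Fin.cast hd) p then 1 else 0 := by
  rw [Phi_ev, Function.update_self, Function.update_of_ne hAB, Function.update_self]
  refine if_congr ?_ rfl rfl
  simp only [Prod.ext_iff, Fin.ext_iff, Prod.map_fst, Prod.map_snd, Fin.val_cast]
  constructor <;> rintro ⟨h1, h2⟩ <;> exact ⟨h1.symm, h2.symm⟩

theorem contract_ev {A B : Sys} (hAB : A ≠ B) (hd : A.dim = B.dim) {R : Op} (hA : A ∈ R.sys)
    (hB : B ∈ R.sys) (f : PairConf) : (contract A B R).ev f = ∑ p, R.ev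
      (Function.update (Function.update f A p) B (Prod.map (Fin.cast hd) (Fin.cast hd) p)) := by
  have h : R.sys ∩ (Phi A B).sys = {A, B} := by
    ext i
    simp only [Phi, Finset.mem_inter, Finset.mem_insert, Finset.mem_singleton]
    constructor
    · exact fun h => h.2
    · rintro (rfl | rfl) <;> simp_all
  rw [contract, link_ev _ _ h, sum_put_pair hAB (fun g => R.ev g * (Phi A B).ev g)]
  simp only [Phi_ev_update hAB hd]
  simp

/-- The entries of `Phi` are the kernel of the identity between the label spaces of `A` and `B`, and
an orthogonal transformation applied on both sides fixes the identity. -/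
theorem hat_Phi {A B : Sys} (hAB : A ≠ B) (hd : A.dim = B.dim) : hat (Phi A B) = Phi A B := by
  refine Op.ext_ev rfl fun f => ?_
  rw [hat_ev' (S := {A, B}) _ rfl,
    sum_put_pair hAB (fun g => kern {A, B} f g * (Phi A B).ev g)]
  simp only [Phi_ev_update hAB hd]
  simp only [kern, Finset.prod_pair hAB, mul_ite, mul_one, mul_zero, Finset.sum_ite_eq',
    Finset.mem_univ, if_true, Function.update_self, Function.update_of_ne hAB]
  rw [Phi_ev]
  obtain ⟨n, k⟩ := A
  obtain ⟨m, l⟩ := B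
  obtain rfl : n = m := by simpa [Sys.dim] using hd
  have h := sum_mix_mul_mix (Nat.le_add_left 2 n) (f (n, k)) (f (n, l))
  have e : ∀ p : Fin (n + 2) × Fin (n + 2), Prod.map (Fin.cast hd) (Fin.cast hd) p = p :=
    fun _ => rfl
  have h' : (f (n, k) = f (n, l)) ↔
      ((f (n, k)).1 : ℕ) = (f (n, l)).1 ∧ ((f (n, k)).2 : ℕ) = (f (n, l)).2 := by
    rw [Prod.ext_iff, Fin.ext_iff, Fin.ext_iff]
  rw [← if_congr h' rfl rfl]
  have h2 := congrArg (fun t : ℝ => (t : ℂ)) h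
  push_cast at h2
  have h3 : ((if f (n, k) = f (n, l) then (1 : ℝ) else 0 : ℝ) : ℂ) =
      if f (n, k) = f (n, l) then (1 : ℂ) else 0 := by split_ifs <;> simp
  rw [← h3, ← h2]
  refine Finset.sum_congr rfl fun p _ => ?_
  rw [mix_comm _ p, mix_comm _ p]
  rfl

theorem posSemidef_indicator {n : Type*} [Finite n] (P : n → Prop) [DecidablePred P] :
    (Matrix.of fun c c' => if P c ∧ P c' then (1 : ℂ) else 0).PosSemidef := by
  convert Matrix.posSemidef_vecMulVec_self_star (fun c => if P c then (1 : ℂ) else 0) using 1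
  ext c c'
  rw [Matrix.vecMulVec_apply, Matrix.of_apply, Pi.star_apply]
  by_cases h : P c <;> by_cases h' : P c' <;> simp [h, h']

theorem Phi_posSemidef (A B : Sys) : (Phi A B).mat.PosSemidef :=
  posSemidef_indicator (n := Config (Phi A B).sys)
    fun c => (c ⟨A, by simp [Phi]⟩ : ℕ) = c ⟨B, by simp [Phi]⟩

-- Allowed supports and the normalisation of a type.

namespace HType

/-- `b` is the support of a component which the deterministic maps of type `x` may have: in the
product basis, a deterministic map differs from the maximally mixed one only by components of this
kind. -/
def DetSupp : HType → Set Sys → Prop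
  | elem s, b => ∃ A ∈ s, A ∈ b
  | arrow x y, b => (x.DetSupp b ∨ ∀ A ∈ x.ele, A ∉ b) → y.DetSupp b

/-- The component of the deterministic maps of type `x` along the normalised identity. -/
def scale : HType → ℝ
  | elem s => ∏ i ∈ s, invSqrt i.dim
  | arrow x y => y.scale / x.scale

theorem scale_pos (x : HType) : 0 < x.scale := by
  induction x with
  | elem s => exact Finset.prod_pos fun i _ => invSqrt_pos (Nat.succ_pos _)
  | arrow x y hx hy => exact div_pos hy hx

theorem DetSupp.exists_mem {x : HType} {b : Set Sys} (h : x.DetSupp b) : ∃ A ∈ x.ele, A ∈ b := by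
  induction x with
  | elem s => exact h
  | arrow x y hx hy =>
    by_cases h1 : ∀ A ∈ x.ele, A ∉ b
    · obtain ⟨A, hA, hb⟩ := hy (h (Or.inr h1))
      exact ⟨A, Finset.mem_union_right _ hA, hb⟩
    · push Not at h1
      obtain ⟨A, hA, hb⟩ := h1
      exact ⟨A, Finset.mem_union_left _ hA, hb⟩

theorem detSupp_congr {x : HType} {b b' : Set Sys} (h : ∀ A ∈ x.ele, A ∈ b ↔ A ∈ b') :
    x.DetSupp b ↔ x.DetSupp b' := by
  induction x with
  | elem s => exact exists_congr fun A => and_congr_right fun hA => h A hA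
  | arrow x y hx hy =>
    have h1 := fun A hA => h A (Finset.mem_union_left _ hA)
    have h2 := fun A hA => h A (Finset.mem_union_right _ hA)
    refine imp_congr (or_congr (hx h1) ?_) (hy h2)
    exact forall₂_congr fun A hA => not_congr (h1 A hA)

theorem ele_ext (x : HType) (E : Finset Sys) : (x.ext E).ele = x.ele ∪ E := by
  induction x with
  | elem s => rfl
  | arrow x y _ hy => simp [ext, ele, hy]

theorem ext_empty (x : HType) : x.ext ∅ = x := by
  induction x with
  | elem s => simp [ext]
  | arrow x y _ hy => simp [ext, hy]

theorem NoRepeat.ext {x : HType} (hx : x.NoRepeat) {E : Finset Sys} (hE : Disjoint E x.ele) :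
    (x.ext E).NoRepeat := by
  induction x with
  | elem s => trivial
  | arrow x y _ hy =>
    obtain ⟨h1, h2, h3⟩ := hx
    rw [ele, Finset.disjoint_union_right] at hE
    refine ⟨h1, hy h2 hE.2, ?_⟩
    rw [ele_ext, Finset.disjoint_union_right]
    exact ⟨h3, hE.1.symm⟩

/-- The extension enlarges only the final output, where every nonempty support is allowed. -/
theorem detSupp_ext (x : HType) (E : Finset Sys) (b : Set Sys) :
    (x.ext E).DetSupp b ↔ x.DetSupp b ∨ ∃ A ∈ E, A ∈ b := by
  induction x with
  | elem s => simp [HType.ext, DetSupp, or_and_right, exists_or]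
  | arrow x y _ hy =>
    simp only [HType.ext, DetSupp, hy]
    tauto

theorem scale_ext {x : HType} {E : Finset Sys} (hE : Disjoint E x.ele) :
    (x.ext E).scale = x.scale * ∏ i ∈ E, invSqrt i.dim := by
  induction x with
  | elem s => exact Finset.prod_union hE.symm
  | arrow x y _ hy =>
    rw [ele, Finset.disjoint_union_right] at hE
    simp only [HType.ext, scale, hy hE.2]
    ring

end HType

-- Affine conditions on deterministic maps.

/-- The systems on which a label is not zero. -/
def supp (f : PairConf) : Set Sys := {i | f i ≠ 0}

theorem mem_supp {f : PairConf} {i : Sys} : i ∈ supp f ↔ f i ≠ 0 := Iff.rfl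

/-- The affine conditions satisfied by the deterministic maps of type `x`. -/
def IsAffine (x : HType) (Q : Op) : Prop :=
  ∀ f, ¬x.DetSupp (supp f) →
    (hat Q).ev f = if ∀ i ∈ x.ele, f i = 0 then (x.scale : ℂ) else 0

/-- Explicit description of the deterministic maps. -/
def IsDet (x : HType) (Q : Op) : Prop :=
  Q.sys = x.ele ∧ Q.mat.PosSemidef ∧ IsAffine x Q

/-- Explicit description of the admissible maps. -/
def IsAdm (x : HType) (Q : Op) : Prop :=
  Q.sys = x.ele ∧ Q.mat.PosSemidef ∧
    ∃ N : Mat Q.sys, (N - Q.mat).PosSemidef ∧ IsDet x ⟨Q.sys, N⟩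

theorem IsDet.isAdm {x : HType} {Q : Op} (h : IsDet x Q) : IsAdm x Q :=
  ⟨h.1, h.2.1, Q.mat, by rw [sub_self]; exact Matrix.PosSemidef.zero, h⟩

/-- The multiple of `vac` becomes a positive multiple of the identity, an interior point of the
positive cone, so a small Hermitian perturbation along allowed components stays deterministic. -/
theorem exists_isDet (x : HType) {S : Finset Sys} (hS : S = x.ele) {X : Mat S}
    (hX : X.IsHermitian) (hsupp : ∀ f, Op.ev ⟨S, X⟩ f ≠ 0 → x.DetSupp (supp f)) :
    ∃ ε : ℝ, 0 < ε ∧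
      IsDet x (hat ⟨S, (x.scale : ℂ) • vac S + (ε : ℂ) • X⟩) := by
  have hl : 0 < x.scale * ∏ i ∈ S, invSqrt i.dim :=
    mul_pos x.scale_pos (Finset.prod_pos fun i _ => invSqrt_pos (Nat.succ_pos _))
  obtain ⟨ε, hε, hpos⟩ := exists_posSemidef_add hl (hat_isHermitian (Q := ⟨S, X⟩) hX)
  refine ⟨ε, hε, hS, ?_, fun f hf => ?_⟩
  · have : hatMat ((x.scale : ℂ) • vac S + (ε : ℂ) • X) =
        ((x.scale * ∏ i ∈ S, invSqrt i.dim : ℝ) : ℂ) • (1 : Mat S) + (ε : ℂ) • hatMat X := by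
      rw [hatMat_add, hatMat_smul, hatMat_smul, hatMat_vac, smul_smul]
      push_cast
      rfl
    change (hatMat _).PosSemidef
    rw [this]
    exact hpos
  · have h0 : Op.ev ⟨S, X⟩ f = 0 := not_not.mp (mt (hsupp f) hf)
    rw [hat_hat]
    change (x.scale : ℂ) * Op.ev ⟨S, vac S⟩ f + (ε : ℂ) * Op.ev ⟨S, X⟩ f = _
    rw [h0, vac_ev, hS]
    simp

theorem isDet_vac (x : HType) {S : Finset Sys} (hS : S = x.ele) :
    IsDet x (hat ⟨S, (x.scale : ℂ) • vac S⟩) := by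
  obtain ⟨ε, -, h⟩ := exists_isDet x hS (X := 0) Matrix.isHermitian_zero
    (fun f hf => (hf rfl).elim)
  simpa using h

/-- For an output label that is not allowed, each term of the sum over labels of `x` has a vanishing
factor: that of `Q` if the label is allowed in `x`, that of `R` if it is neither allowed nor zero.
Only the zero label survives, and there the scales multiply. -/
theorem isAffine_link {x y : HType} {E : Finset Sys} {Q R : Op} (hxy : Disjoint x.ele y.ele)
    (hE : Disjoint E (x.ele ∪ y.ele)) (hQs : Q.sys = x.ele ∪ y.ele) (hRs : R.sys = x.ele ∪ E)
    (hQ : IsAffine (.arrow x y) Q) (hR : IsAffine (x.ext E) R) :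
    IsAffine (y.ext E) (link Q R) := by
  rw [Finset.disjoint_union_right] at hE
  intro f hf
  have hH : (hat Q).sys ∩ (hat R).sys = x.ele := by
    change Q.sys ∩ R.sys = _
    rw [hQs, hRs, ← Finset.union_inter_distrib_left, Finset.disjoint_iff_inter_eq_empty.mp hE.2.symm,
      Finset.union_empty]
  rw [HType.detSupp_ext, not_or] at hf
  obtain ⟨hfy, hfE⟩ := hf
  push Not at hfE
  have hfE' : ∀ i ∈ E, f i = 0 := fun i hi => not_not.mp (hfE i hi)
  have hy : ∀ (a : PairOn x.ele), ∀ i ∈ y.ele, put a f i = f i := fun a i hi =>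
    put_notMem _ _ (Finset.disjoint_right.mp hxy hi)
  have hEf : ∀ (a : PairOn x.ele), ∀ i ∈ E, put a f i = 0 := fun a i hi => by
    rw [put_notMem _ _ (Finset.disjoint_left.mp hE.1 hi), hfE' i hi]
  have hDy : ∀ a : PairOn x.ele, ¬y.DetSupp (supp (put a f)) := fun a h => hfy
    ((HType.detSupp_congr fun i hi => by rw [mem_supp, mem_supp, hy a i hi]).mp h)
  have hDR : ∀ a : PairOn x.ele, ¬x.DetSupp (supp (put a f)) → (hat R).ev (put a f) =
      if ∀ i ∈ x.ele, put a f i = 0 then ((x.ext E).scale : ℂ) else 0 := by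
    intro a ha
    rw [hR _ (by
      rw [HType.detSupp_ext, not_or]
      refine ⟨ha, ?_⟩
      rintro ⟨i, hi, h⟩
      exact h (hEf a i hi))]
    refine if_congr ?_ rfl rfl
    rw [HType.ele_ext, Finset.forall_mem_union]
    exact and_iff_left (hEf a)
  rw [hat_link, link_ev _ _ hH,
    sum_put_eq_single f (fun g => (hat Q).ev g * (hat R).ev g) 0]
  · set a : PairOn x.ele := fun i => (0 : PairConf) i with ha
    have h0 : ∀ i ∈ x.ele, put a f i = 0 := fun i hi => by rw [put_mem _ _ hi]; rfl
    have hnx : ¬x.DetSupp (supp (put a f)) := by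
      intro h
      obtain ⟨A, hA, hb⟩ := h.exists_mem
      exact hb (h0 A hA)
    rw [hDR a hnx, if_pos h0, hQ _ (fun h => hDy a (h (Or.inr fun A hA hb => hb (h0 A hA))))]
    have hiff : (∀ i ∈ (HType.arrow x y).ele, put a f i = 0) ↔
        ∀ i ∈ (y.ext E).ele, f i = 0 := by
      rw [HType.ele_ext, HType.ele, Finset.forall_mem_union, Finset.forall_mem_union,
        and_iff_right h0, and_iff_left hfE']
      exact forall₂_congr fun i hi => by rw [hy a i hi]
    rw [if_congr hiff rfl rfl, ite_mul, zero_mul, HType.scale_ext hE.1, HType.scale_ext hE.2,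
      HType.scale]
    congr 1
    have := x.scale_pos.ne'
    rw [← Complex.ofReal_mul]
    congr 1
    field_simp
  · rintro a ⟨i, hi⟩
    have hne : ¬∀ i ∈ x.ele, put a f i = 0 := by
      intro h
      apply hi
      simpa [put_mem _ _ i.2] using h i i.2
    by_cases hx : x.DetSupp (supp (put a f))
    · rw [hQ _ (fun h => hDy a (h (Or.inl hx))), if_neg, zero_mul]
      exact fun h => hne fun i hi => h i (Finset.mem_union_left _ hi)
    · rw [hDR a hx, if_neg hne, mul_zero]

/-- The indicator of the labels which agree with `f` on `S`. -/
def indMat (S : Finset Sys) (f : PairConf) : Mat S :=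
  fun c c' => if ∀ i : S, (c i, c' i) = f i then 1 else 0

theorem indMat_ev (S : Finset Sys) (f g : PairConf) :
    Op.ev ⟨S, indMat S f⟩ g = if ∀ i ∈ S, g i = f i then 1 else 0 :=
  if_congr ⟨fun h i hi => h ⟨i, hi⟩, fun h i => h i i.2⟩ rfl rfl

theorem indMat_conjTranspose (S : Finset Sys) (f : PairConf) :
    (indMat S f).conjTranspose = indMat S (fun i => (f i).swap) := by
  ext c c'
  rw [Matrix.conjTranspose_apply]
  unfold indMat
  have : (∀ i : S, (c' i, c i) = f i) ↔ ∀ i : S, (c i, c' i) = (f i).swap :=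
    forall_congr' fun i => by rw [← Prod.swap_inj, Prod.swap_prod_mk]
  rw [if_congr this rfl rfl]
  split_ifs <;> simp

/-- The maximally mixed input determines the components that are trivial on `x`. Subtracting its
image from that of a perturbed input shows that allowed input directions contribute nothing to
forbidden output components. -/
theorem isAffine_of_sends {x y : HType} {Q : Op}
    (hQs : Q.sys = x.ele ∪ y.ele) (hQ : ∀ R, IsDet x R → IsAffine y (link Q R)) :
    IsAffine (.arrow x y) Q := by
  have hH : ∀ X : Mat x.ele, (hat Q).sys ∩ (⟨x.ele, X⟩ : Op).sys = x.ele := by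
    intro X
    change Q.sys ∩ x.ele = _
    rw [hQs]
    exact Finset.inter_eq_right.mpr Finset.subset_union_left
  -- the component of the output along the maximally mixed input
  have key0 : ∀ f, ¬y.DetSupp (supp f) →
      (x.scale : ℂ) * (hat Q).ev (put (S := x.ele) (fun i => (0 : PairConf) i) f) =
        if ∀ i ∈ y.ele, f i = 0 then (y.scale : ℂ) else 0 := by
    intro f hf
    rw [← hQ _ (isDet_vac x rfl) f hf, hat_link, hat_hat, link_ev _ _ (hH _),
      sum_put_eq_single f (fun g => (hat Q).ev g * Op.ev ⟨x.ele, (x.scale : ℂ) • vac x.ele⟩ g) 0]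
    · change _ = _ * ((x.scale : ℂ) * Op.ev ⟨x.ele, vac x.ele⟩ _)
      rw [vac_ev, if_pos, mul_one, mul_comm]
      intro i hi
      rw [put_mem _ _ hi]
      rfl
    · rintro a ⟨i, hi⟩
      change _ * ((x.scale : ℂ) * Op.ev ⟨x.ele, vac x.ele⟩ _) = 0
      rw [vac_ev, if_neg, mul_zero, mul_zero]
      intro h
      apply hi
      simpa [put_mem _ _ i.2] using h i i.2
  have key1 : ∀ f, ¬y.DetSupp (supp f) → ∀ X : Mat x.ele, X.IsHermitian →
      (∀ g, Op.ev ⟨x.ele, X⟩ g ≠ 0 → x.DetSupp (supp g)) →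
      ∑ a : PairOn x.ele, (hat Q).ev (put a f) * Op.ev ⟨x.ele, X⟩ (put a f) = 0 := by
    intro f hf X hX hsupp
    obtain ⟨ε, hε, hdet⟩ := exists_isDet x rfl hX hsupp
    have h1 := hQ _ hdet f hf
    have h0 := hQ _ (isDet_vac x rfl) f hf
    rw [hat_link, hat_hat, link_ev _ _ (hH _)] at h1 h0
    rw [← h0] at h1
    have e : ∀ g, Op.ev ⟨x.ele, (x.scale : ℂ) • vac x.ele + (ε : ℂ) • X⟩ g =
        Op.ev ⟨x.ele, (x.scale : ℂ) • vac x.ele⟩ g + (ε : ℂ) * Op.ev ⟨x.ele, X⟩ g := fun g => rfl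
    simp only [e, mul_add, Finset.sum_add_distrib, mul_left_comm _ (ε : ℂ), ← Finset.mul_sum] at h1
    have h2 := add_eq_left.mp h1
    exact (mul_eq_zero.mp h2).resolve_left (by exact_mod_cast hε.ne')
  intro f hf
  simp only [HType.DetSupp, Classical.not_imp] at hf
  obtain ⟨hx, hy⟩ := hf
  rcases hx with hx | hx
  · obtain ⟨A, hA, hAf⟩ := hx.exists_mem
    rw [if_neg (fun h => hAf (h A (Finset.mem_union_left _ hA)))]
    set f' : PairConf := fun i => (f i).swap with hf'
    have hsum : ∀ g : PairConf, ∑ a : PairOn x.ele, (hat Q).ev (put a f) *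
        Op.ev ⟨x.ele, indMat x.ele g⟩ (put a f) =
          (hat Q).ev (put (S := x.ele) (fun i => g i) f) := by
      intro g
      rw [sum_put_eq_single f (fun h => (hat Q).ev h * Op.ev ⟨x.ele, indMat x.ele g⟩ h) g]
      · rw [indMat_ev, if_pos, mul_one]
        intro i hi
        rw [put_mem _ _ hi]
      · rintro a ⟨i, hi⟩
        rw [indMat_ev, if_neg, mul_zero]
        intro h
        apply hi
        rw [← h i i.2, put_mem _ _ i.2]
    have hs1 : ∀ g, Op.ev ⟨x.ele, indMat x.ele f⟩ g ≠ 0 → x.DetSupp (supp g) := by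
      intro g hg
      rw [indMat_ev] at hg
      have h : ∀ i ∈ x.ele, g i = f i := by
        by_contra h
        exact hg (if_neg h)
      exact (HType.detSupp_congr fun i hi => by rw [mem_supp, mem_supp, h i hi]).mp hx
    have hs2 : ∀ g, Op.ev ⟨x.ele, indMat x.ele f'⟩ g ≠ 0 → x.DetSupp (supp g) := by
      intro g hg
      rw [indMat_ev] at hg
      have h : ∀ i ∈ x.ele, g i = (f i).swap := by
        by_contra h
        exact hg (if_neg h)
      have hz : ∀ i, (f i).swap = 0 ↔ f i = 0 := fun i => by simp [Prod.ext_iff, and_comm]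
      exact (HType.detSupp_congr fun i hi => by
        rw [mem_supp, mem_supp, h i hi, Ne, Ne, hz]).mp hx
    have hT : (indMat x.ele f).conjTranspose = indMat x.ele f' := indMat_conjTranspose _ _
    have hT' : (indMat x.ele f').conjTranspose = indMat x.ele f := by
      rw [← hT, Matrix.conjTranspose_conjTranspose]
    -- The indicator of `f` need not be Hermitian. Its two Hermitian combinations show that the sum
    -- and the difference of the entries at `f` and at its transpose on `x` vanish, hence so does
    -- the entry at `f`.
    have r1 := key1 f hy (indMat x.ele f + indMat x.ele f')
      (by rw [Matrix.IsHermitian, Matrix.conjTranspose_add, hT, hT', add_comm])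
      (fun g hg => by
        by_contra hD
        have a1 := not_not.mp (mt (hs1 g) hD)
        have a2 := not_not.mp (mt (hs2 g) hD)
        apply hg
        change Op.ev ⟨x.ele, indMat x.ele f⟩ g + Op.ev ⟨x.ele, indMat x.ele f'⟩ g = 0
        rw [a1, a2, add_zero])
    have r2 := key1 f hy (Complex.I • (indMat x.ele f - indMat x.ele f'))
      (by
        rw [Matrix.IsHermitian, Matrix.conjTranspose_smul, Matrix.conjTranspose_sub, hT, hT',
          Complex.star_def, Complex.conj_I, neg_smul, ← smul_neg, neg_sub])
      (fun g hg => by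
        by_contra hD
        have a1 := not_not.mp (mt (hs1 g) hD)
        have a2 := not_not.mp (mt (hs2 g) hD)
        apply hg
        change Complex.I *
          (Op.ev ⟨x.ele, indMat x.ele f⟩ g - Op.ev ⟨x.ele, indMat x.ele f'⟩ g) = 0
        rw [a1, a2, sub_zero, mul_zero])
    have e1 : ∀ g, Op.ev ⟨x.ele, indMat x.ele f + indMat x.ele f'⟩ g =
      Op.ev ⟨x.ele, indMat x.ele f⟩ g + Op.ev ⟨x.ele, indMat x.ele f'⟩ g := fun g => rfl
    have e2 : ∀ g, Op.ev ⟨x.ele, Complex.I • (indMat x.ele f - indMat x.ele f')⟩ g = Complex.I *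
      (Op.ev ⟨x.ele, indMat x.ele f⟩ g - Op.ev ⟨x.ele, indMat x.ele f'⟩ g) := fun g => rfl
    simp only [e1, mul_add, Finset.sum_add_distrib, hsum] at r1
    simp only [e2, mul_left_comm _ Complex.I, ← Finset.mul_sum, mul_sub, Finset.sum_sub_distrib,
      hsum] at r2
    rw [put_self] at r1 r2
    have r3 := sub_eq_zero.mp r2
    have r4 := mul_left_cancel₀ Complex.I_ne_zero r3
    rw [← r4, ← two_mul] at r1
    exact (mul_eq_zero.mp r1).resolve_left two_ne_zero
  · have hx0 : ∀ i ∈ x.ele, f i = 0 := fun i hi => not_not.mp (hx i hi)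
    have hput : put (S := x.ele) (fun i => (0 : PairConf) i) f = f := by
      funext i
      by_cases hi : i ∈ x.ele
      · rw [put_mem _ _ hi, hx0 i hi]
        rfl
      · rw [put_notMem _ _ hi]
    have h := key0 f hy
    rw [hput] at h
    have hiff : (∀ i ∈ (HType.arrow x y).ele, f i = 0) ↔ ∀ i ∈ y.ele, f i = 0 := by
      rw [HType.ele, Finset.forall_mem_union, and_iff_right hx0]
    have hc : (x.scale : ℂ) ≠ 0 := by exact_mod_cast x.scale_pos.ne'
    rw [if_congr hiff rfl rfl, HType.scale]
    split_ifs at h ⊢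
    · rw [Complex.ofReal_div, ← h, mul_div_cancel_left₀ _ hc]
    · exact (mul_eq_zero.mp h).resolve_left hc

/-! ### Complete positivity -/

/-- The `N`-th next system of the same dimension. -/
def Sys.shift (N : ℕ) (i : Sys) : Sys := (i.1, i.2 + N)

/-- The inverse of `Sys.shift`. -/
def Sys.unshift (N : ℕ) (i : Sys) : Sys := (i.1, i.2 - N)

theorem Sys.unshift_shift (N : ℕ) (i : Sys) : Sys.unshift N (Sys.shift N i) = i := by
  simp [Sys.unshift, Sys.shift]

theorem exists_shift_disjoint (S T : Finset Sys) :
    ∃ N, Disjoint (S.image (Sys.shift N)) T := by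
  refine ⟨T.sup (fun i => i.2) + 1, ?_⟩
  rw [Finset.disjoint_left]
  intro i hi hT
  obtain ⟨j, -, rfl⟩ := Finset.mem_image.mp hi
  have := Finset.le_sup (f := fun i : Sys => i.2) hT
  simp only [Sys.shift] at this
  omega

/-- The unnormalised maximally entangled operator of the systems in `S` and their copies. -/
def entMat (N : ℕ) (S : Finset Sys) : Mat (S ∪ S.image (Sys.shift N)) :=
  Matrix.of fun c c' =>
    if (∀ i : S, (c ⟨i, Finset.mem_union_left _ i.2⟩ : ℕ) =
        c ⟨Sys.shift N i, Finset.mem_union_right _ (Finset.mem_image_of_mem _ i.2)⟩) ∧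
      (∀ i : S, (c' ⟨i, Finset.mem_union_left _ i.2⟩ : ℕ) =
        c' ⟨Sys.shift N i, Finset.mem_union_right _ (Finset.mem_image_of_mem _ i.2)⟩) then 1 else 0

theorem entMat_ev (N : ℕ) (S : Finset Sys) (f : PairConf) :
    Op.ev ⟨_, entMat N S⟩ f =
      if ∀ i ∈ S, ((f i).1 : ℕ) = (f (Sys.shift N i)).1 ∧ ((f i).2 : ℕ) = (f (Sys.shift N i)).2
      then 1 else 0 := by
  refine if_congr ?_ rfl rfl
  constructor
  · rintro ⟨h1, h2⟩ i hi
    exact ⟨h1 ⟨i, hi⟩, h2 ⟨i, hi⟩⟩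
  · intro h
    exact ⟨fun i => (h i i.2).1, fun i => (h i i.2).2⟩

theorem entMat_posSemidef (N : ℕ) (S : Finset Sys) : (entMat N S).PosSemidef :=
  posSemidef_indicator (n := Config (S ∪ S.image (Sys.shift N)))
    fun c => ∀ i : S, (c ⟨i, Finset.mem_union_left _ i.2⟩ : ℕ) =
        c ⟨Sys.shift N i, Finset.mem_union_right _ (Finset.mem_image_of_mem _ i.2)⟩

/-- The maximally mixed map is a positive multiple of the identity, so it dominates a small multiple
of any positive operator. -/
theorem exists_isAdm_smul (x : HType) {S : Finset Sys} (hS : S = x.ele) {M : Mat S}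
    (hM : M.PosSemidef) : ∃ ε : ℝ, 0 < ε ∧ IsAdm x ⟨S, (ε : ℂ) • M⟩ := by
  have hl : 0 < x.scale * ∏ i ∈ S, invSqrt i.dim :=
    mul_pos x.scale_pos (Finset.prod_pos fun i _ => invSqrt_pos (Nat.succ_pos _))
  obtain ⟨ε, hε, hpos⟩ := exists_posSemidef_add hl hM.isHermitian.neg
  refine ⟨ε, hε, hS, hM.smul (by exact_mod_cast hε.le), hatMat ((x.scale : ℂ) • vac S), ?_,
    isDet_vac x hS⟩
  rw [hatMat_smul, hatMat_vac, smul_smul]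
  convert hpos using 1
  rw [smul_neg, ← sub_eq_add_neg]
  push_cast
  rfl

/-- Choi's argument: applied to half of a maximally entangled operator between the systems of `x`
and fresh copies, the map returns its own Choi operator. That input is admissible after rescaling.
-/
theorem posSemidef_of_sends {x y : HType} {S : Finset Sys} (hS : S = x.ele ∪ y.ele) {M : Mat S}
    (hM : ∀ E, Disjoint E S → ∀ R, IsAdm (x.ext E) R → (link ⟨S, M⟩ R).mat.PosSemidef) :
    M.PosSemidef := by
  obtain ⟨N, hN⟩ := exists_shift_disjoint x.ele S
  obtain ⟨ε, hε, hadm⟩ := exists_isAdm_smul (x.ext (x.ele.image (Sys.shift N)))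
    (HType.ele_ext _ _).symm (entMat_posSemidef N x.ele)
  have hpos := hM _ hN _ hadm
  -- `G` repeats the value on a system at its copy, so that `M` reappears as a submatrix; the
  -- default `0` elsewhere is immaterial.
  let G : Config S → (i : Sys) → Fin i.dim := fun c i =>
    if h : i ∈ S then c ⟨i, h⟩ else
      if h' : Sys.unshift N i ∈ S then (c ⟨Sys.unshift N i, h'⟩ : Fin (i.1 + 2)) else 0
  have h1 : (ε : ℂ) • M = (link ⟨S, M⟩ ⟨_, (ε : ℂ) • entMat N x.ele⟩).mat.submatrix
      (fun c i => G c i) (fun c i => G c i) := by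
    ext c c'
    let F : PairConf := fun i => (G c i, G c' i)
    have hF : ∀ i ∈ x.ele, ((F i).1 : ℕ) = (F (Sys.shift N i)).1 ∧
        ((F i).2 : ℕ) = (F (Sys.shift N i)).2 := by
      intro i hi
      have hiS : i ∈ S := hS ▸ Finset.mem_union_left _ hi
      have hns : Sys.shift N i ∉ S :=
        Finset.disjoint_left.mp hN (Finset.mem_image_of_mem _ hi)
      have hG : ∀ c : Config S, G c (Sys.shift N i) = G c i := by
        intro c
        have hu : Sys.unshift N (Sys.shift N i) ∈ S := by rwa [Sys.unshift_shift]
        simp only [G, dif_neg hns, dif_pos hiS]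
        apply Fin.ext
        refine Eq.trans (congrArg Fin.val (dif_pos hu)) ?_
        have : ∀ (j : Sys) (hj : j ∈ S), j = i → (c ⟨j, hj⟩ : ℕ) = c ⟨i, hiS⟩ := by
          rintro j hj rfl
          rfl
        exact this _ hu (Sys.unshift_shift N i)
      exact ⟨(congrArg Fin.val (hG c)).symm, (congrArg Fin.val (hG c')).symm⟩
    have hev : (link ⟨S, M⟩ ⟨_, (ε : ℂ) • entMat N x.ele⟩).ev F = (ε : ℂ) * M c c' := by
      have hH : (⟨S, M⟩ : Op).sys ∩ (⟨_, (ε : ℂ) • entMat N x.ele⟩ : Op).sys = x.ele := by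
        change S ∩ (x.ele ∪ x.ele.image (Sys.shift N)) = x.ele
        rw [Finset.inter_union_distrib_left, Finset.disjoint_iff_inter_eq_empty.mp hN.symm,
          Finset.union_empty, hS]
        exact Finset.inter_eq_right.mpr Finset.subset_union_left
      rw [link_ev _ _ hH, sum_put_eq_single F (fun g => Op.ev ⟨S, M⟩ g *
        Op.ev ⟨_, (ε : ℂ) • entMat N x.ele⟩ g) F, put_self]
      · change _ * ((ε : ℂ) * Op.ev ⟨_, entMat N x.ele⟩ F) = _
        rw [entMat_ev, if_pos hF, mul_one, mul_comm]
        congr 1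
        change M (fun i => G c i) (fun i => G c' i) = _
        congr 1 <;> funext i <;> simp [G]
      · rintro a ⟨i, hi⟩
        change _ * ((ε : ℂ) * Op.ev ⟨_, entMat N x.ele⟩ (put a F)) = _
        rw [entMat_ev, if_neg, mul_zero, mul_zero]
        intro h
        apply hi
        have hns : Sys.shift N i ∉ x.ele := fun hmem => Finset.disjoint_left.mp hN
          (Finset.mem_image_of_mem _ i.2) (hS ▸ Finset.mem_union_left _ hmem)
        have h2 := h i i.2
        rw [put_mem _ _ i.2, put_notMem _ _ hns] at h2
        exact Prod.ext (Fin.ext (h2.1.trans (hF i i.2).1.symm))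
          (Fin.ext (h2.2.trans (hF i i.2).2.symm))
    exact hev.symm
  have h2 : M = ((ε⁻¹ : ℝ) : ℂ) • ((ε : ℂ) • M) := by
    rw [smul_smul, ← Complex.ofReal_mul, inv_mul_cancel₀ hε.ne', Complex.ofReal_one, one_smul]
  rw [h2, h1]
  exact (hpos.submatrix _).smul (by exact_mod_cast (inv_pos.mpr hε).le)

/-! ### The characterisation of admissible and deterministic maps -/

theorem isDet_link {x y : HType} {E : Finset Sys} {Q R : Op} (hxy : Disjoint x.ele y.ele)
    (hE : Disjoint E (x.ele ∪ y.ele)) (hQ : IsDet (.arrow x y) Q) (hR : IsDet (x.ext E) R) :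
    IsDet (y.ext E) (link Q R) := by
  have hRs := hR.1.trans (HType.ele_ext x E)
  refine ⟨?_, link_posSemidef hQ.2.1 hR.2.1,
    isAffine_link hxy hE hQ.1 hRs hQ.2.2 hR.2.2⟩
  rw [Finset.disjoint_union_right] at hE
  have h1 := Finset.disjoint_left.mp hxy
  have h2 := Finset.disjoint_left.mp hE.1
  have h3 := Finset.disjoint_left.mp hE.2
  change symmDiff Q.sys R.sys = _
  rw [hQ.1, hRs, HType.ele_ext, HType.ele]
  ext i
  have h1 := @h1 i
  have h2 := @h2 i
  have h3 := @h3 i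
  simp only [Finset.mem_symmDiff, Finset.mem_union]
  tauto

/-- If `N` dominates `Q` and `L` dominates `R`, then `N * L - Q * R = (N - Q) * L + Q * (L - R)` for
the link product, and both terms are positive. -/
theorem isAdm_link {x y : HType} {E : Finset Sys} {Q R : Op} (hxy : Disjoint x.ele y.ele)
    (hE : Disjoint E (x.ele ∪ y.ele)) (hQ : IsAdm (.arrow x y) Q) (hR : IsAdm (x.ext E) R) :
    IsAdm (y.ext E) (link Q R) := by
  obtain ⟨hQs, hQp, N, hNQ, hN⟩ := hQ
  obtain ⟨hRs, hRp, L, hLR, hL⟩ := hR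
  have h := isDet_link hxy hE hN hL
  refine ⟨h.1, link_posSemidef hQp hRp, linkMat ⟨Q.sys, N⟩ ⟨R.sys, L⟩, ?_, h⟩
  have h1 : (linkMat ⟨Q.sys, N - Q.mat⟩ ⟨R.sys, L⟩).PosSemidef := link_posSemidef hNQ hL.2.1
  have h2 : (linkMat Q ⟨R.sys, L - R.mat⟩).PosSemidef := link_posSemidef hQp hLR
  rw [linkMat_sub_left] at h1
  rw [linkMat_sub_right] at h2
  have h3 := h1.add h2
  have e : linkMat ⟨Q.sys, N⟩ ⟨R.sys, L⟩ - linkMat ⟨Q.sys, Q.mat⟩ ⟨R.sys, L⟩ +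
      (linkMat Q ⟨R.sys, L⟩ - linkMat Q ⟨R.sys, R.mat⟩) =
      linkMat ⟨Q.sys, N⟩ ⟨R.sys, L⟩ - linkMat Q R := sub_add_sub_cancel _ _ _
  rw [e] at h3
  exact h3

theorem isDet_elem_iff (s : Finset Sys) (M : Mat s) :
    IsDet (.elem s) ⟨s, M⟩ ↔ M.PosSemidef ∧ M.trace = 1 := by
  have hne : (∏ i ∈ s, (invSqrt i.dim : ℂ)) ≠ 0 := Finset.prod_ne_zero_iff.mpr fun i _ => by
    exact_mod_cast (invSqrt_pos (Nat.succ_pos _)).ne'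
  have hz : ∀ f, ¬(HType.elem s).DetSupp (supp f) ↔ ∀ i ∈ s, f i = 0 := by
    intro f
    simp [HType.DetSupp, mem_supp]
  constructor
  · rintro ⟨-, h1, h2⟩
    refine ⟨h1, ?_⟩
    have h0 : ∀ i ∈ s, (0 : PairConf) i = 0 := fun _ _ => rfl
    have h3 := h2 0 ((hz 0).mpr h0)
    rw [hat_ev_zero ⟨s, M⟩ h0, if_pos (c := ∀ i ∈ (HType.elem s).ele, (0 : PairConf) i = 0) h0,
      HType.scale] at h3
    push_cast at h3
    exact mul_left_cancel₀ hne (h3.trans (mul_one _).symm)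
  · rintro ⟨h1, h2⟩
    refine ⟨rfl, h1, fun f hf => ?_⟩
    have h0 := (hz f).mp hf
    rw [hat_ev_zero ⟨s, M⟩ h0, if_pos (c := ∀ i ∈ (HType.elem s).ele, f i = 0) h0, h2, mul_one,
      HType.scale]
    push_cast
    rfl

/-- The induction runs over the number of arrows because extension does not change it, so the
hypothesis covers all extensions of `x` and `y` at once. -/
theorem mem_maps_iff (n : ℕ) : ∀ x : HType, x.size = n → x.NoRepeat →
    (∀ Q, Q ∈ DetMaps x ↔ IsDet x Q) ∧ (∀ Q, Q ∈ AdmMaps x ↔ IsAdm x Q) := by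
  induction n using Nat.strong_induction_on with
  | _ n ih =>
  intro x hn hx
  cases x with
  | elem s =>
    constructor
    · intro Q
      rw [DetMaps, mapSets]
      constructor
      · rintro ⟨M, rfl, h⟩
        exact (isDet_elem_iff s M).mpr h
      · intro h
        obtain ⟨S, M⟩ := Q
        obtain rfl : S = s := h.1
        exact ⟨M, rfl, (isDet_elem_iff S M).mp h⟩
    · intro Q
      rw [AdmMaps, mapSets]
      constructor
      · rintro ⟨M, rfl, h, N, hN, ht, hMN⟩
        exact ⟨rfl, h, N, hMN, (isDet_elem_iff s N).mpr ⟨hN, ht⟩⟩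
      · rintro ⟨h, hp, N, hMN, hN⟩
        obtain ⟨S, M⟩ := Q
        obtain rfl : S = s := h
        obtain ⟨h1, h2⟩ := (isDet_elem_iff S N).mp hN
        exact ⟨M, rfl, hp, N, h1, h2, hMN⟩
  | arrow x y =>
    obtain ⟨hx1, hy1, hxy⟩ := hx
    have hsx : ∀ E, (x.ext E).size < n := fun E => by
      rw [HType.size_ext, ← hn, HType.size]
      omega
    have hsy : ∀ E, (y.ext E).size < n := fun E => by
      rw [HType.size_ext, ← hn, HType.size]
      omega
    have IHx : ∀ E, Disjoint E (x.ele ∪ y.ele) → _ := fun E hE => ih _ (hsx E) (x.ext E) rfl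
      (hx1.ext (Finset.disjoint_union_right.mp hE).1)
    have IHy : ∀ E, Disjoint E (x.ele ∪ y.ele) → _ := fun E hE => ih _ (hsy E) (y.ext E) rfl
      (hy1.ext (Finset.disjoint_union_right.mp hE).2)
    have sendsAdm : ∀ M : Mat (x.ele ∪ y.ele), ExtMapsTo (x.ele ∪ y.ele) (fun E => (mapSets (x.ext E)).adm)
        (fun E => (mapSets (y.ext E)).adm) M ↔
        ∀ E, Disjoint E (x.ele ∪ y.ele) → ∀ R, IsAdm (x.ext E) R → IsAdm (y.ext E) (link ⟨_, M⟩ R) := fun M =>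
      forall₂_congr fun E hE => forall_congr' fun R =>
        imp_congr ((IHx E hE).2 R) ((IHy E hE).2 _)
    have sendsDet : ∀ M : Mat (x.ele ∪ y.ele), ExtMapsTo (x.ele ∪ y.ele) (fun E => (mapSets (x.ext E)).det)
        (fun E => (mapSets (y.ext E)).det) M ↔
        ∀ E, Disjoint E (x.ele ∪ y.ele) → ∀ R, IsDet (x.ext E) R → IsDet (y.ext E) (link ⟨_, M⟩ R) := fun M =>
      forall₂_congr fun E hE => forall_congr' fun R =>
        imp_congr ((IHx E hE).1 R) ((IHy E hE).1 _)
    have pos : ∀ M : Mat (x.ele ∪ y.ele),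
        (∀ E, Disjoint E (x.ele ∪ y.ele) → ∀ R, IsAdm (x.ext E) R → IsAdm (y.ext E) (link ⟨_, M⟩ R)) →
        M.PosSemidef := fun M h => posSemidef_of_sends rfl fun E hE R hR => (h E hE R hR).2.1
    have det : ∀ M : Mat (x.ele ∪ y.ele), M.PosSemidef →
        (∀ E, Disjoint E (x.ele ∪ y.ele) → ∀ R, IsDet (x.ext E) R → IsDet (y.ext E) (link ⟨_, M⟩ R)) →
        IsDet (.arrow x y) ⟨_, M⟩ := by
      intro M hM h
      refine ⟨rfl, hM, isAffine_of_sends rfl fun R hR => ?_⟩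
      -- The trivial ancilla already yields the affine conditions; positivity is known separately.
      have h0 := h ∅ (Finset.disjoint_empty_left _) R
      rw [HType.ext_empty, HType.ext_empty] at h0
      exact (h0 hR).2.2
    have adm_iff : ∀ Q, Q ∈ AdmMaps (.arrow x y) ↔ IsAdm (.arrow x y) Q := by
      intro Q
      rw [AdmMaps, mapSets]
      simp only [Set.mem_ofPred_eq, sendsAdm, sendsDet]
      constructor
      · rintro ⟨M, rfl, h1, k, N, hN, hsum⟩
        have hNp : (∑ i, N i).PosSemidef :=
          Matrix.posSemidef_sum _ fun i _ => pos _ (hN i)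
        refine ⟨rfl, pos M h1, M + ∑ i, N i, ?_, det _ ((pos M h1).add hNp) hsum⟩
        change (M + ∑ i, N i - M).PosSemidef
        rwa [add_sub_cancel_left]
      · intro h
        obtain ⟨T, M⟩ := Q
        obtain rfl : T = x.ele ∪ y.ele := h.1
        refine ⟨M, rfl, fun E hE R hR => isAdm_link hxy hE h hR, ?_⟩
        obtain ⟨-, hp, N, hMN, hN⟩ := h
        -- A single complement suffices: `N - M` is positive and lies below the deterministic `N`.
        refine ⟨1, fun _ => N - M, fun _ E hE R hR => isAdm_link hxy hE ⟨rfl, hMN, N, ?_, hN⟩ hR, ?_⟩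
        · change (N - (N - M)).PosSemidef
          rwa [sub_sub_cancel]
        · rw [Fin.sum_univ_one, add_sub_cancel]
          exact fun E hE R hR => isDet_link hxy hE hN hR
    refine ⟨fun Q => ?_, adm_iff⟩
    have hdet : Q ∈ DetMaps (.arrow x y) ↔ ∃ M : Mat (x.ele ∪ y.ele), Q = ⟨_, M⟩ ∧ Q ∈ AdmMaps (.arrow x y) ∧
        ExtMapsTo (x.ele ∪ y.ele) (fun E => (mapSets (x.ext E)).det) (fun E => (mapSets (y.ext E)).det) M := by
      rw [DetMaps, AdmMaps, mapSets]
      constructor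
      · rintro ⟨M, rfl, h1, h2⟩
        exact ⟨M, rfl, ⟨M, rfl, h1⟩, h2⟩
      · rintro ⟨M, rfl, ⟨M', h, h1⟩, h2⟩
        obtain rfl : M = M' := by simpa using h
        exact ⟨M, rfl, h1, h2⟩
    rw [hdet]
    simp only [adm_iff, sendsDet]
    constructor
    · rintro ⟨M, rfl, h1, h2⟩
      exact det M h1.2.1 h2
    · intro h
      obtain ⟨T, M⟩ := Q
      obtain rfl : T = x.ele ∪ y.ele := h.1
      exact ⟨M, rfl, h.isAdm, fun E hE R hR => isDet_link hxy hE h hR⟩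

theorem mem_detMaps_iff {x : HType} (hx : x.NoRepeat) (Q : Op) : Q ∈ DetMaps x ↔ IsDet x Q :=
  (mem_maps_iff _ x rfl hx).1 Q

theorem mem_admMaps_iff {x : HType} (hx : x.NoRepeat) (Q : Op) : Q ∈ AdmMaps x ↔ IsAdm x Q :=
  (mem_maps_iff _ x rfl hx).2 Q

namespace HType

/-! ### Inputs and outputs -/

theorem countP_tokens (x : HType) : x.tokens.countP Token.isArrOrLpar = 2 * x.size := by
  induction x with
  | elem s => rfl
  | arrow x y hx hy =>
    simp only [tokens, List.countP_append, hx, hy, size, List.countP_singleton,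
      Token.isArrOrLpar]
    simp
    ring

theorem exists_token_iff (x : HType) (A : Sys) :
    (∃ t ∈ x.tokens, t.isSys A = true) ↔ A ∈ x.ele := by
  induction x with
  | elem s => simp [tokens, Token.isSys, ele]
  | arrow x y hx hy =>
    rw [ele, Finset.mem_union, ← hx, ← hy]
    simp only [tokens, List.mem_append, List.mem_singleton]
    constructor
    · rintro ⟨t, (((rfl | h) | rfl) | h) | rfl, ht⟩
      · simp [Token.isSys] at ht
      · exact Or.inl ⟨t, h, ht⟩
      · simp [Token.isSys] at ht
      · exact Or.inr ⟨t, h, ht⟩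
      · simp [Token.isSys] at ht
    · rintro (⟨t, h, ht⟩ | ⟨t, h, ht⟩)
      · exact ⟨t, by tauto, ht⟩
      · exact ⟨t, by tauto, ht⟩

theorem K_lt_two (x : HType) (A : Sys) : x.K A < 2 := Nat.mod_lt _ two_pos

theorem K_elem (s : Finset Sys) (A : Sys) : (elem s).K A = 0 := by
  by_cases h : A ∈ s <;>
    simp [K, tokens, Token.isSys, h, Token.isArrOrLpar, List.dropWhile]

/-- To the right of `A` the new arrow adds one symbol, the expression of `y` adds an even number by
`countP_tokens`, and the new open bracket lies to the left. -/
theorem K_arrow_left {x y : HType} {A : Sys} (hA : A ∈ x.ele) :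
    (arrow x y).K A = (x.K A + 1) % 2 := by
  have hne : (x.tokens.dropWhile fun t => !(t.isSys A)) ≠ [] := by
    rw [Ne, List.dropWhile_eq_nil_iff]
    obtain ⟨t, ht, h⟩ := (exists_token_iff x A).mpr hA
    intro hall
    simpa [h] using hall t ht
  have e : (arrow x y).tokens = [Token.lpar] ++ (x.tokens ++ ([Token.arr] ++ y.tokens ++
      [Token.rpar])) := by simp [tokens]
  rw [K, e, List.dropWhile_append_of_pos (by simp [Token.isSys]), List.dropWhile_append,
    if_neg (by simpa using hne), List.countP_append, List.countP_append, List.countP_append,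
    countP_tokens, K]
  simp [Token.isArrOrLpar]
  omega

theorem K_arrow_right {x y : HType} {A : Sys} (hx : A ∉ x.ele) (hA : A ∈ y.ele) :
    (arrow x y).K A = y.K A := by
  have hall : ∀ t ∈ [Token.lpar] ++ x.tokens ++ [Token.arr], (!(t.isSys A)) = true := by
    intro t ht
    simp only [List.mem_append, List.mem_singleton] at ht
    obtain (rfl | ht) | rfl := ht
    · rfl
    · by_contra h
      exact hx ((exists_token_iff x A).mp ⟨t, ht, by simpa using h⟩)
    · rfl
  have hne : (y.tokens.dropWhile fun t => !(t.isSys A)) ≠ [] := by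
    rw [Ne, List.dropWhile_eq_nil_iff]
    obtain ⟨t, ht, h⟩ := (exists_token_iff y A).mpr hA
    intro hall
    simpa [h] using hall t ht
  have e : (arrow x y).tokens = ([Token.lpar] ++ x.tokens ++ [Token.arr]) ++ (y.tokens ++
      [Token.rpar]) := by simp [tokens]
  rw [K, e, List.dropWhile_append_of_pos hall, List.dropWhile_append,
    if_neg (by simpa using hne), List.countP_append, K]
  simp [Token.isArrOrLpar]

theorem mem_ins {x : HType} {A : Sys} : A ∈ x.ins ↔ A ∈ x.ele ∧ x.K A = 1 := Finset.mem_filter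

theorem mem_outs {x : HType} {A : Sys} : A ∈ x.outs ↔ A ∈ x.ele ∧ x.K A = 0 := by
  rw [outs, Finset.mem_sdiff, mem_ins]
  have := x.K_lt_two A
  constructor
  · rintro ⟨h1, h2⟩
    refine ⟨h1, ?_⟩
    have : x.K A ≠ 1 := fun h => h2 ⟨h1, h⟩
    omega
  · rintro ⟨h1, h2⟩
    exact ⟨h1, fun h => by omega⟩

theorem ins_subset (x : HType) : x.ins ⊆ x.ele := Finset.filter_subset _ _

theorem outs_subset (x : HType) : x.outs ⊆ x.ele := Finset.sdiff_subset

theorem disjoint_ins_outs (x : HType) : Disjoint x.ins x.outs := Finset.disjoint_sdiff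

theorem ins_union_outs (x : HType) : x.ins ∪ x.outs = x.ele :=
  Finset.union_sdiff_of_subset x.ins_subset

theorem ins_elem (s : Finset Sys) : (elem s).ins = ∅ := by
  ext A
  simp [mem_ins, K_elem]

theorem outs_elem (s : Finset Sys) : (elem s).outs = s := by
  rw [outs, ins_elem, Finset.sdiff_empty, ele]

theorem ins_arrow {x y : HType} (h : Disjoint x.ele y.ele) :
    (arrow x y).ins = x.outs ∪ y.ins := by
  ext A
  rw [mem_ins, Finset.mem_union, mem_outs, mem_ins, ele, Finset.mem_union]
  have hx := x.K_lt_two A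
  by_cases h1 : A ∈ x.ele
  · have h2 := Finset.disjoint_left.mp h h1
    simp only [h1, h2, K_arrow_left h1]
    simp
    omega
  · by_cases h2 : A ∈ y.ele
    · simp [h1, h2, K_arrow_right h1 h2]
    · simp [h1, h2]

theorem outs_arrow {x y : HType} (h : Disjoint x.ele y.ele) :
    (arrow x y).outs = x.ins ∪ y.outs := by
  ext A
  rw [mem_outs, Finset.mem_union, mem_ins, mem_outs, ele, Finset.mem_union]
  have hx := x.K_lt_two A
  by_cases h1 : A ∈ x.ele
  · have h2 := Finset.disjoint_left.mp h h1
    simp only [h1, h2, K_arrow_left h1]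
    simp
    omega
  · by_cases h2 : A ∈ y.ele
    · simp [h1, h2, K_arrow_right h1 h2]
    · simp [h1, h2]

/-- A nonzero component without inputs is allowed, and an allowed component has an output. -/
theorem detSupp_ins_outs {x : HType} (hx : x.NoRepeat) (b : Set Sys) :
    (x.DetSupp b → ∃ B ∈ x.outs, B ∈ b) ∧
      ((∃ B ∈ x.ele, B ∈ b) → (∀ A ∈ x.ins, A ∉ b) → x.DetSupp b) := by
  induction x with
  | elem s => exact ⟨fun h => by rwa [outs_elem], fun h _ => h⟩
  | arrow x y ihx ihy =>
    obtain ⟨h1, h2, h3⟩ := hx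
    obtain ⟨ax, bx⟩ := ihx h1
    obtain ⟨ay, bY⟩ := ihy h2
    rw [outs_arrow h3, ins_arrow h3, ele]
    -- The arrow exchanges inputs and outputs of `x`, so each half for the arrow uses the opposite
    -- half for `x` and the same half for `y`.
    constructor
    · intro h
      by_contra! hno
      rw [Finset.forall_mem_union] at hno
      have hnx : ¬(x.DetSupp b ∨ ∀ A ∈ x.ele, A ∉ b) := fun hd => by
        obtain ⟨B, hB, hb⟩ := ay (h hd)
        exact hno.2 B hB hb
      push Not at hnx
      exact hnx.1 (bx hnx.2 hno.1)
    · rintro ⟨B, hB, hb⟩ hno hd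
      rw [Finset.forall_mem_union] at hno
      rcases hd with hd | hd
      · obtain ⟨C, hC, hCb⟩ := ax hd
        exact (hno.1 C hC hCb).elim
      · have hBy := (Finset.mem_union.mp hB).resolve_left fun h => hd B h hb
        exact bY ⟨B, hBy, hb⟩ hno.2

theorem DetSupp.exists_outs {x : HType} (hx : x.NoRepeat) {b : Set Sys} (h : x.DetSupp b) :
    ∃ B ∈ x.outs, B ∈ b := (detSupp_ins_outs hx b).1 h

theorem detSupp_of_ins {x : HType} (hx : x.NoRepeat) {b : Set Sys} (h : ∃ B ∈ x.ele, B ∈ b)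
    (hno : ∀ A ∈ x.ins, A ∉ b) : x.DetSupp b := (detSupp_ins_outs hx b).2 h hno

/-- Discarding inputs and adding outputs preserves the allowed components. -/
theorem DetSupp.mono {x : HType} (hx : x.NoRepeat) {b b' : Set Sys}
    (hi : ∀ A ∈ x.ins, A ∈ b' → A ∈ b) (ho : ∀ A ∈ x.outs, A ∈ b → A ∈ b')
    (h : x.DetSupp b) : x.DetSupp b' := by
  induction x generalizing b b' with
  | elem s =>
    obtain ⟨A, hA, hb⟩ := h
    exact ⟨A, hA, ho A (by rwa [outs_elem]) hb⟩
  | arrow x y ihx ihy =>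
    obtain ⟨h1, h2, h3⟩ := hx
    rw [ins_arrow h3, Finset.forall_mem_union] at hi
    rw [outs_arrow h3, Finset.forall_mem_union] at ho
    intro hd
    refine ihy h2 hi.2 ho.2 (h ?_)
    rcases hd with hd | hd
    · exact Or.inl (ihx h1 ho.1 hi.1 hd)
    -- Here `b'` is empty on `x`. The inputs of `x` are outputs of the arrow, so `b` contains none
    -- of them; a nonempty part of `b` on `x` is therefore allowed.
    · by_cases he : ∀ A ∈ x.ele, A ∉ b
      · exact Or.inr he
      · push Not at he
        exact Or.inl (detSupp_of_ins h1 he fun A hA hb =>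
          hd A (x.ins_subset hA) (ho.1 A hA hb))

theorem prod_invSqrt_pos (S : Finset Sys) : 0 < ∏ i ∈ S, invSqrt i.dim :=
  Finset.prod_pos fun _ _ => invSqrt_pos (Nat.succ_pos _)

/-- The scale thus depends only on which systems are inputs and which are outputs, and not on the
structure of the type. -/
theorem scale_mul_prod_ins {x : HType} (hx : x.NoRepeat) :
    x.scale * ∏ i ∈ x.ins, invSqrt i.dim = ∏ i ∈ x.outs, invSqrt i.dim := by
  induction x with
  | elem s => simp [ins_elem, outs_elem, scale]
  | arrow x y ihx ihy =>
    obtain ⟨h1, h2, h3⟩ := hx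
    have hx := ihx h1
    have hy := ihy h2
    rw [ins_arrow h3, outs_arrow h3, scale,
      Finset.prod_union (h3.mono x.outs_subset y.ins_subset),
      Finset.prod_union (h3.mono x.ins_subset y.outs_subset), ← hx, ← hy]
    have := x.scale_pos.ne'
    field_simp

/-! ### Tensor products -/

/-- `b` is empty on the systems of `x` or the support of an allowed component. -/
def NullOrDetSupp (x : HType) (b : Set Sys) : Prop := x.DetSupp b ∨ ∀ A ∈ x.ele, A ∉ b

/-- A functional into the trivial type negates the condition, so the double negation in the tensor
product leaves a conjunction. Including the empty support makes the rule exact. -/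
theorem nullOrDetSupp_tensor (x y : HType) (b : Set Sys) :
    (x.tensor y).NullOrDetSupp b ↔ x.NullOrDetSupp b ∧ y.NullOrDetSupp b := by
  simp only [NullOrDetSupp, tensor, bar, DetSupp, triv, ele, Finset.union_empty,
    Finset.forall_mem_union, Finset.notMem_empty, false_and, exists_false]
  tauto

theorem scale_tensor (x y : HType) : (x.tensor y).scale = x.scale * y.scale := by
  have := x.scale_pos.ne'
  have := y.scale_pos.ne'
  simp only [tensor, bar, scale, triv, Finset.prod_empty]
  field_simp

theorem ele_tensor (x y : HType) : (x.tensor y).ele = x.ele ∪ y.ele := by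
  simp [tensor, bar, ele, triv]

theorem noRepeat_tensor {x y : HType} (hx : x.NoRepeat) (hy : y.NoRepeat)
    (h : Disjoint x.ele y.ele) : (x.tensor y).NoRepeat := by
  simp [tensor, bar, NoRepeat, triv, ele, hx, hy, h]

/-- The type of a family of channels without signalling between them. -/
def wires (H : List (Sys × Sys)) : HType :=
  bigTensor (H.map fun p => arrow (elem {p.2}) (elem {p.1}))

theorem nullOrDetSupp_wires (H : List (Sys × Sys)) (b : Set Sys) :
    (wires H).NullOrDetSupp b ↔ ∀ p ∈ H, p.2 ∈ b → p.1 ∈ b := by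
  have h1 : ∀ p : Sys × Sys, (arrow (elem {p.2}) (elem {p.1})).NullOrDetSupp b ↔
      (p.2 ∈ b → p.1 ∈ b) := by
    intro p
    simp only [NullOrDetSupp, DetSupp, ele, Finset.mem_union, Finset.mem_singleton, exists_eq_left,
      forall_eq, or_imp, forall_and]
    tauto
  induction H with
  | nil => simp [wires, bigTensor, NullOrDetSupp, triv, ele]
  | cons p H ih =>
    cases H with
    | nil => simpa [wires, bigTensor] using h1 p
    | cons q H =>
      rw [List.forall_mem_cons]
      exact (nullOrDetSupp_tensor _ _ b).trans (and_congr (h1 p) ih)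

theorem scale_wires {H : List (Sys × Sys)} (hd : ∀ p ∈ H, p.1.dim = p.2.dim) :
    (wires H).scale = 1 := by
  have h1 : ∀ p ∈ H, (arrow (elem {p.2}) (elem {p.1})).scale = 1 := by
    intro p hp
    simp only [scale, Finset.prod_singleton, hd p hp]
    exact div_self (invSqrt_pos (Nat.succ_pos _)).ne'
  induction H with
  | nil => simp [wires, bigTensor, triv, scale]
  | cons p H ih =>
    rw [List.forall_mem_cons] at hd h1
    cases H with
    | nil => exact h1.1
    | cons q H =>
      refine (scale_tensor _ _).trans ?_
      rw [h1.1, one_mul]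
      exact ih hd.2 h1.2

theorem mem_ele_wires (H : List (Sys × Sys)) (i : Sys) :
    i ∈ (wires H).ele ↔ ∃ p ∈ H, i = p.1 ∨ i = p.2 := by
  induction H with
  | nil => simp [wires, bigTensor, triv, ele]
  | cons p H ih =>
    have h1 : i ∈ (arrow (elem {p.2}) (elem {p.1})).ele ↔ i = p.1 ∨ i = p.2 := by
      simp [ele, or_comm]
    have h2 : (∃ r ∈ p :: H, i = r.1 ∨ i = r.2) ↔ (i = p.1 ∨ i = p.2) ∨
        ∃ r ∈ H, i = r.1 ∨ i = r.2 := by simp only [List.mem_cons, exists_eq_or_imp]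
    rw [h2]
    cases H with
    | nil => simpa [wires, bigTensor] using h1
    | cons q H =>
      have h3 : (wires (p :: q :: H)).ele = (arrow (elem {p.2}) (elem {p.1})).ele ∪
        (wires (q :: H)).ele := ele_tensor _ _
      rw [h3, Finset.mem_union]
      exact or_congr h1 ih

theorem noRepeat_wires {H : List (Sys × Sys)} (hne : ∀ p ∈ H, p.1 ≠ p.2)
    (hH : H.Pairwise fun p q => Disjoint ({p.1, p.2} : Finset Sys) {q.1, q.2}) :
    (wires H).NoRepeat := by
  induction H with
  | nil => trivial
  | cons p H ih =>
    rw [List.forall_mem_cons] at hne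
    rw [List.pairwise_cons] at hH
    have h1 : (arrow (elem {p.2}) (elem {p.1})).NoRepeat :=
      ⟨trivial, trivial, by simpa [ele] using hne.1.symm⟩
    cases H with
    | nil => exact h1
    | cons q H =>
      refine noRepeat_tensor h1 (ih hne.2 hH.2) ?_
      rw [Finset.disjoint_left]
      intro i hi hi'
      obtain ⟨r, hr, hir⟩ := (mem_ele_wires (q :: H) i).mp hi'
      refine Finset.disjoint_left.mp (hH.1 r hr) ?_ (by simpa using hir)
      simp only [ele, Finset.mem_union, Finset.mem_singleton] at hi
      simpa [or_comm] using hi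

end HType

/-! ### Multiple contractions -/

/-- The pairs in `H` are pairs of distinct systems in `S` of the same dimension, and they are
mutually disjoint. -/
structure Wiring (S : Finset Sys) (H : List (Sys × Sys)) : Prop where
  pair : ∀ p ∈ H, p.1 ∈ S ∧ p.2 ∈ S ∧ p.1 ≠ p.2 ∧ p.1.dim = p.2.dim
  disj : H.Pairwise fun p q => Disjoint ({p.1, p.2} : Finset Sys) {q.1, q.2}

/-- The system is not contracted. -/
def Untouched (H : List (Sys × Sys)) (i : Sys) : Prop := ∀ p ∈ H, i ≠ p.1 ∧ i ≠ p.2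

theorem untouched_cons {p : Sys × Sys} {H : List (Sys × Sys)} {i : Sys} :
    Untouched (p :: H) i ↔ (i ≠ p.1 ∧ i ≠ p.2) ∧ Untouched H i := List.forall_mem_cons

/-- A label takes the same values on the two systems of a pair. -/
def Matched (g : PairConf) (p : Sys × Sys) : Prop :=
  ((g p.1).1 : ℕ) = (g p.2).1 ∧ ((g p.1).2 : ℕ) = (g p.2).2

theorem Wiring.tail {S : Finset Sys} {p : Sys × Sys} {H : List (Sys × Sys)}
    (h : Wiring S (p :: H)) : Wiring S H :=
  ⟨fun q hq => h.pair q (List.mem_cons_of_mem _ hq), (List.pairwise_cons.mp h.disj).2⟩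

theorem Wiring.head_untouched {S : Finset Sys} {p : Sys × Sys} {H : List (Sys × Sys)}
    (h : Wiring S (p :: H)) : Untouched H p.1 ∧ Untouched H p.2 := by
  have hd := (List.pairwise_cons.mp h.disj).1
  constructor <;> intro q hq
  · have := Finset.disjoint_left.mp (hd q hq) (Finset.mem_insert_self _ _)
    simpa using this
  · have := Finset.disjoint_left.mp (hd q hq)
      (Finset.mem_insert_of_mem (Finset.mem_singleton_self p.2))
    simpa using this

theorem multiContract_cons (p : Sys × Sys) (H : List (Sys × Sys)) (Q : Op) :
    multiContract (p :: H) Q = contract p.1 p.2 (multiContract H Q) := rfl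

theorem mem_sys_multiContract {H : List (Sys × Sys)} {Q : Op} (h : Wiring Q.sys H) (i : Sys) :
    i ∈ (multiContract H Q).sys ↔ i ∈ Q.sys ∧ Untouched H i := by
  induction H generalizing i with
  | nil => simp [multiContract, Untouched]
  | cons p H ih =>
    have ih := ih h.tail
    obtain ⟨h1, h2, -, -⟩ := h.pair p List.mem_cons_self
    obtain ⟨u1, u2⟩ := h.head_untouched
    have e : (multiContract (p :: H) Q).sys =
      symmDiff (multiContract H Q).sys {p.1, p.2} := rfl
    have m1 := (ih p.1).mpr ⟨h1, u1⟩
    have m2 := (ih p.2).mpr ⟨h2, u2⟩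
    rw [e, Finset.mem_symmDiff, untouched_cons, Finset.mem_insert, Finset.mem_singleton, ih]
    constructor
    · rintro (⟨⟨a, b⟩, c⟩ | ⟨rfl | rfl, c⟩)
      · exact ⟨a, not_or.mp c, b⟩
      · exact (c ⟨h1, u1⟩).elim
      · exact (c ⟨h2, u2⟩).elim
    · rintro ⟨a, c, b⟩
      exact Or.inl ⟨⟨a, b⟩, not_or.mpr c⟩

theorem multiContract_posSemidef {H : List (Sys × Sys)} {Q : Op} (hQ : Q.mat.PosSemidef) :
    (multiContract H Q).mat.PosSemidef := by
  induction H with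
  | nil => exact hQ
  | cons p H ih => exact link_posSemidef ih (Phi_posSemidef _ _)

theorem hat_multiContract {H : List (Sys × Sys)} {Q : Op} (h : Wiring Q.sys H) :
    hat (multiContract H Q) = multiContract H (hat Q) := by
  induction H with
  | nil => rfl
  | cons p H ih =>
    obtain ⟨-, -, hne, hd⟩ := h.pair p List.mem_cons_self
    rw [multiContract_cons, contract, hat_link, hat_Phi hne hd, ih h.tail]
    rfl

theorem multiContract_cons_ev {p : Sys × Sys} {H : List (Sys × Sys)} {Q : Op}
    (h : Wiring Q.sys (p :: H)) (hd : p.1.dim = p.2.dim) (f : PairConf) :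
    (multiContract (p :: H) Q).ev f = ∑ q, (multiContract H Q).ev
      (Function.update (Function.update f p.1 q) p.2
        (Prod.map (Fin.cast hd) (Fin.cast hd) q)) := by
  obtain ⟨h1, h2, hne, -⟩ := h.pair p List.mem_cons_self
  obtain ⟨u1, u2⟩ := h.head_untouched
  exact contract_ev hne hd ((mem_sys_multiContract h.tail _).mpr ⟨h1, u1⟩)
    ((mem_sys_multiContract h.tail _).mpr ⟨h2, u2⟩) f

theorem cast_eq_zero_iff {m n : ℕ} [NeZero m] [NeZero n] (h : m = n) (q : Fin m × Fin m) :
    Prod.map (Fin.cast h) (Fin.cast h) q = 0 ↔ q = 0 := by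
  subst h
  rfl

/-- A multiple contraction has a single nonzero term if the other labels do not contribute. -/
theorem multiContract_ev_eq {H : List (Sys × Sys)} {Q : Op} (h : Wiring Q.sys H) (f : PairConf)
    (v : ℂ) (hv : ∀ g : PairConf, (∀ i, Untouched H i → g i = f i) →
      (∀ p ∈ H, g p.1 = 0 ↔ g p.2 = 0) → Q.ev g = if ∀ p ∈ H, g p.1 = 0 then v else 0) :
    (multiContract H Q).ev f = v := by
  induction H generalizing f v with
  | nil =>
    change Q.ev f = v
    simpa using hv f (fun _ _ => rfl) (by simp)
  | cons p H ih =>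
    obtain ⟨h1, h2, hne, hd⟩ := h.pair p List.mem_cons_self
    obtain ⟨u1, u2⟩ := h.head_untouched
    rw [multiContract_cons_ev h hd]
    -- With the first pair fixed at `q`, the induction applies with value `v` or `0` according to
    -- whether `q` is the identity label.
    have key : ∀ q : Fin p.1.dim × Fin p.1.dim, (multiContract H Q).ev
        (Function.update (Function.update f p.1 q) p.2
          (Prod.map (Fin.cast hd) (Fin.cast hd) q)) = if q = 0 then v else 0 := by
      intro q
      refine ih h.tail _ _ fun g hg hm => ?_
      have g1 : g p.1 = q := by
        rw [hg _ u1, Function.update_of_ne hne, Function.update_self]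
      have g2 : g p.2 = Prod.map (Fin.cast hd) (Fin.cast hd) q := by
        rw [hg _ u2, Function.update_self]
      rw [hv g]
      · have e : (∀ r ∈ p :: H, g r.1 = 0) ↔ q = 0 ∧ ∀ r ∈ H, g r.1 = 0 := by
          rw [List.forall_mem_cons, g1]
        rw [if_congr e rfl rfl, ite_and]
        by_cases hq : q = 0
        · rw [if_pos hq, if_pos hq]
        · rw [if_neg hq, if_neg hq, ite_self]
      · intro i hi
        obtain ⟨⟨i1, i2⟩, hi⟩ := untouched_cons.mp hi
        rw [hg i hi, Function.update_of_ne i2, Function.update_of_ne i1]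
      · rw [List.forall_mem_cons]
        refine ⟨?_, hm⟩
        rw [g1, g2]
        exact (cast_eq_zero_iff hd q).symm
    simp only [key]
    simp

/-- The matched labels bound a multiple contraction of a nonnegative operator from below. -/
theorem sum_le_multiContract_ev {H : List (Sys × Sys)} {Q : Op} (h : Wiring Q.sys H)
    (hQ : ∀ g, 0 ≤ Q.ev g) (f : PairConf) (G : Finset PairConf)
    (hG : ∀ g ∈ G, (∀ i, Untouched H i → g i = f i) ∧ ∀ p ∈ H, Matched g p) :
    ∑ g ∈ G, Q.ev g ≤ (multiContract H Q).ev f := by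
  induction H generalizing f G with
  | nil =>
    have : G ⊆ {f} := fun g hg => Finset.mem_singleton.mpr
      (funext fun i => (hG g hg).1 i (fun p hp => absurd hp List.not_mem_nil))
    exact (Finset.sum_le_sum_of_subset_of_nonneg this fun g _ _ => hQ g).trans_eq
      (Finset.sum_singleton _ _)
  | cons p H ih =>
    obtain ⟨h1, h2, hne, hd⟩ := h.pair p List.mem_cons_self
    -- Sort the labels in `G` by their value on `p.1`; matching then fixes the value on `p.2`, so
    -- each fibre belongs to one term of the outer contraction.
    rw [multiContract_cons_ev h hd, ← Finset.sum_fiberwise G (fun g => g p.1)]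
    refine Finset.sum_le_sum fun q _ => ih h.tail _ _ fun g hg => ?_
    obtain ⟨hgG, hq⟩ := Finset.mem_filter.mp hg
    obtain ⟨ha, hm⟩ := hG g hgG
    rw [List.forall_mem_cons] at hm
    refine ⟨fun i hi => ?_, hm.2⟩
    by_cases i2 : i = p.2
    · subst i2
      rw [Function.update_self]
      have := hm.1
      rw [Matched, hq] at this
      exact Prod.ext (Fin.ext this.1.symm) (Fin.ext this.2.symm)
    · rw [Function.update_of_ne i2]
      by_cases i1 : i = p.1
      · subst i1
        rw [Function.update_self, hq]
      · rw [Function.update_of_ne i1]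
        exact ha i (untouched_cons.mpr ⟨⟨i1, i2⟩, hi⟩)

/-! ### Deterministic maps with all allowed components -/

theorem supp_swap (f : PairConf) : supp (fun i => (f i).swap) = supp f := by
  ext i
  rw [mem_supp, mem_supp, Ne, Ne, not_iff_not]
  simp [Prod.ext_iff, and_comm]

-- A generic deterministic map: it detects every allowed support, and its components are
-- nonnegative, so that contractions of it show no cancellation.
open Classical in
theorem exists_isDet_full (x : HType) : ∃ ε : ℝ, 0 < ε ∧ ∃ R : Op, IsDet x R ∧
    ∀ f, (hat R).ev f = (if ∀ i ∈ x.ele, f i = 0 then (x.scale : ℂ) else 0) +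
      if x.DetSupp (supp f) then (ε : ℂ) else 0 := by
  let X : Mat x.ele := fun c c' => if x.DetSupp (supp (extend c c')) then 1 else 0
  have hX : ∀ f, Op.ev ⟨x.ele, X⟩ f = if x.DetSupp (supp f) then 1 else 0 := by
    intro f
    refine if_congr (HType.detSupp_congr fun i hi => ?_) rfl rfl
    rw [mem_supp, mem_supp, extend, put_mem _ _ hi]
  have hherm : X.IsHermitian := by
    refine (isHermitian_iff_ev ⟨x.ele, X⟩).mpr fun f => ?_
    rw [hX, hX, supp_swap]
    split_ifs <;> simp
  obtain ⟨ε, hε, hdet⟩ := exists_isDet x rfl hherm (fun f hf => by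
    rw [hX] at hf
    by_contra h
    exact hf (if_neg h))
  refine ⟨ε, hε, _, hdet, fun f => ?_⟩
  rw [hat_hat]
  change (x.scale : ℂ) * Op.ev ⟨x.ele, vac x.ele⟩ f + (ε : ℂ) * Op.ev ⟨x.ele, X⟩ f = _
  rw [vac_ev, hX]
  simp

/-- A label with a given support. -/
def labelOf (b : Finset Sys) : PairConf := fun i => if i ∈ b then (1, 1) else 0

/-- Every dimension is at least two, so the entry `1` differs from `0`. -/
theorem supp_labelOf (b : Finset Sys) : supp (labelOf b) = b := by
  ext i
  rw [mem_supp, labelOf]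
  by_cases h : i ∈ b <;> simp [h]

theorem labelOf_eq_zero {b : Finset Sys} {i : Sys} : labelOf b i = 0 ↔ i ∉ b := by
  have : i ∈ supp (labelOf b) ↔ i ∈ b := by simp [supp_labelOf]
  rw [← this, mem_supp, not_not]

-- Inclusion of types as inclusion of allowed supports.

/-- Inclusion concerns admissible maps, but equal scales fix equal traces for deterministic maps of
both types. Hence a deterministic map of `x` is deterministic for `y`, and the generic one exhibits
every allowed support. -/
theorem included_iff {x y : HType} (hx : x.NoRepeat) (hy : y.NoRepeat) (he : x.ele = y.ele)
    (hs : x.scale = y.scale) :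
    x.Included y ↔ ∀ b : Finset Sys, x.DetSupp b → y.DetSupp b := by
  classical
  constructor
  · intro h b hb
    obtain ⟨ε, hε, R, hR, hev⟩ := exists_isDet_full x
    have hadm := h ((mem_admMaps_iff hx R).mpr hR.isAdm)
    obtain ⟨hRs, -, N, hNR, hN⟩ := (mem_admMaps_iff hy R).mp hadm
    have hnull : ∀ z : HType, ¬z.DetSupp (supp 0) := fun z hz => by
      obtain ⟨A, -, hA⟩ := hz.exists_mem
      exact hA rfl
    have t1 := hR.2.2 0 (hnull x)
    have t2 := hN.2.2 0 (hnull y)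
    rw [hat_ev_zero R (f := 0) fun _ _ => rfl, if_pos fun _ _ => by rfl] at t1
    rw [hat_ev_zero ⟨R.sys, N⟩ (f := 0) fun _ _ => rfl, if_pos fun _ _ => by rfl] at t2
    have hne : (∏ i ∈ R.sys, (invSqrt i.dim : ℂ)) ≠ 0 := by
      exact_mod_cast (HType.prod_invSqrt_pos R.sys).ne'
    have ht : N.trace = R.mat.trace := mul_left_cancel₀ hne (by rw [t1, hs, ← t2])
    -- A positive matrix of trace zero vanishes, so `R` equals the deterministic map dominating it.
    have hz : N - R.mat = 0 := hNR.trace_eq_zero_iff.mp (by rw [Matrix.trace_sub, ht, sub_self])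
    have hRN : R = ⟨R.sys, N⟩ := by rw [sub_eq_zero.mp hz]
    have hRy : IsDet y R := by
      rw [hRN]
      exact hN
    by_contra hyb
    rw [← supp_labelOf b] at hb hyb
    obtain ⟨A, hA, hAb⟩ := hb.exists_mem
    have hx0 : ¬∀ i ∈ x.ele, labelOf b i = 0 := fun h0 => hAb (h0 A hA)
    have e := hRy.2.2 _ hyb
    rw [hev, ← he, if_neg hx0, if_pos hb, if_neg hx0, zero_add] at e
    exact hε.ne' (by exact_mod_cast e)
  · intro h
    have hD : ∀ b : Set Sys, x.DetSupp b → y.DetSupp b := by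
      intro b hb
      have e : ∀ A ∈ x.ele, A ∈ b ↔ A ∈ ((x.ele.filter (· ∈ b) : Finset Sys) : Set Sys) := by
        intro A hA
        simp [hA]
      exact (HType.detSupp_congr (fun A hA => e A (he ▸ hA))).mpr
        (h _ ((HType.detSupp_congr e).mp hb))
    have hdet : ∀ Q, IsDet x Q → IsDet y Q := by
      rintro Q ⟨h1, h2, h3⟩
      refine ⟨h1.trans he, h2, fun f hf => ?_⟩
      rw [h3 f (fun hb => hf (hD _ hb)), he, hs]
    intro Q hQ
    obtain ⟨h1, h2, N, h3, h4⟩ := (mem_admMaps_iff hx Q).mp hQ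
    exact (mem_admMaps_iff hy Q).mpr ⟨h1.trans he, h2, N, h3, hdet _ h4⟩

-- Contractions of inputs with outputs, and the causality criterion.

/-- The pairs in `H` are mutually disjoint and consist of an input and an output of `x` of the same
dimension. -/
structure Feedback (x : HType) (H : List (Sys × Sys)) : Prop where
  pair : ∀ p ∈ H, p.1 ∈ x.ins ∧ p.2 ∈ x.outs ∧ p.1.dim = p.2.dim
  disj : H.Pairwise fun p q => Disjoint ({p.1, p.2} : Finset Sys) {q.1, q.2}

namespace Feedback

variable {x : HType} {H : List (Sys × Sys)}

theorem ne (h : Feedback x H) : ∀ p ∈ H, p.1 ≠ p.2 := fun p hp he =>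
  Finset.disjoint_left.mp x.disjoint_ins_outs (h.pair p hp).1 (he ▸ (h.pair p hp).2.1)

theorem wiring (h : Feedback x H) : Wiring x.ele H :=
  ⟨fun p hp => ⟨x.ins_subset (h.pair p hp).1, x.outs_subset (h.pair p hp).2.1, h.ne p hp,
    (h.pair p hp).2.2⟩, h.disj⟩

theorem eq_of_fst_eq (h : Feedback x H) {p q : Sys × Sys} (hp : p ∈ H) (hq : q ∈ H)
    (he : p.1 = q.1) : p = q := by
  by_contra hne
  have : Std.Symm fun p q : Sys × Sys => Disjoint ({p.1, p.2} : Finset Sys) {q.1, q.2} :=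
    ⟨fun _ _ hd => hd.symm⟩
  have := h.disj.forall hp hq hne
  exact Finset.disjoint_left.mp this (Finset.mem_insert_self _ _)
    (he ▸ Finset.mem_insert_self _ _)

/-- The inputs which are not contracted. -/
abbrev restIns (x : HType) (H : List (Sys × Sys)) : Finset Sys :=
  x.ins \ (H.map Prod.fst).toFinset

/-- The outputs which are not contracted. -/
abbrev restOuts (x : HType) (H : List (Sys × Sys)) : Finset Sys :=
  x.outs \ (H.map Prod.snd).toFinset

theorem mem_fsts {i : Sys} : i ∈ (H.map Prod.fst).toFinset ↔ ∃ p ∈ H, p.1 = i := by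
  rw [List.mem_toFinset, List.mem_map]

theorem mem_snds {i : Sys} : i ∈ (H.map Prod.snd).toFinset ↔ ∃ p ∈ H, p.2 = i := by
  rw [List.mem_toFinset, List.mem_map]

theorem mem_rest_iff (h : Feedback x H) {i : Sys} :
    i ∈ restIns x H ∪ restOuts x H ↔ i ∈ x.ele ∧ Untouched H i := by
  rw [← x.ins_union_outs, Finset.mem_union, Finset.mem_union, Finset.mem_sdiff, Finset.mem_sdiff,
    mem_fsts, mem_snds]
  have hd := Finset.disjoint_left.mp x.disjoint_ins_outs
  constructor
  · rintro (⟨h1, h2⟩ | ⟨h1, h2⟩)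
    · refine ⟨Or.inl h1, fun p hp => ⟨fun he => h2 ⟨p, hp, he.symm⟩, ?_⟩⟩
      rintro rfl
      exact hd h1 (h.pair p hp).2.1
    · refine ⟨Or.inr h1, fun p hp => ⟨?_, fun he => h2 ⟨p, hp, he.symm⟩⟩⟩
      rintro rfl
      exact hd (h.pair p hp).1 h1
  · rintro ⟨h1 | h1, h2⟩
    · refine Or.inl ⟨h1, ?_⟩
      rintro ⟨p, hp, he⟩
      exact (h2 p hp).1 he.symm
    · refine Or.inr ⟨h1, ?_⟩
      rintro ⟨p, hp, he⟩
      exact (h2 p hp).2 he.symm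

theorem disjoint_rest : Disjoint (restIns x H) (restOuts x H) :=
  x.disjoint_ins_outs.mono Finset.sdiff_subset Finset.sdiff_subset

theorem prod_fsts_eq (h : Feedback x H) :
    ∏ i ∈ (H.map Prod.fst).toFinset, invSqrt i.dim =
      ∏ i ∈ (H.map Prod.snd).toFinset, invSqrt i.dim := by
  have n1 : (H.map Prod.fst).Nodup := by
    refine List.pairwise_map.mpr (h.disj.imp fun {p q} hd he => ?_)
    exact Finset.disjoint_left.mp hd (Finset.mem_insert_self _ _)
      (he ▸ Finset.mem_insert_self _ _)
  have n2 : (H.map Prod.snd).Nodup := by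
    refine List.pairwise_map.mpr (h.disj.imp fun {p q} hd he => ?_)
    exact Finset.disjoint_left.mp hd (Finset.mem_insert_of_mem (Finset.mem_singleton_self _))
      (he ▸ Finset.mem_insert_of_mem (Finset.mem_singleton_self _))
  rw [List.prod_toFinset _ n1, List.prod_toFinset _ n2, List.map_map, List.map_map]
  congr 1
  refine List.map_congr_left fun p hp => ?_
  simp only [Function.comp_apply, (h.pair p hp).2.2]

/-- The dimensions of contracted inputs and outputs cancel in pairs. -/
theorem scale_mul_prod_restIns (hx : x.NoRepeat) (h : Feedback x H) :
    x.scale * ∏ i ∈ restIns x H, invSqrt i.dim = ∏ i ∈ restOuts x H, invSqrt i.dim := by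
  have s1 : (H.map Prod.fst).toFinset ⊆ x.ins := by
    intro i hi
    obtain ⟨p, hp, rfl⟩ := mem_fsts.mp hi
    exact (h.pair p hp).1
  have s2 : (H.map Prod.snd).toFinset ⊆ x.outs := by
    intro i hi
    obtain ⟨p, hp, rfl⟩ := mem_snds.mp hi
    exact (h.pair p hp).2.1
  have e := HType.scale_mul_prod_ins hx
  rw [← Finset.prod_sdiff s1, ← Finset.prod_sdiff s2, h.prod_fsts_eq, ← mul_assoc] at e
  exact mul_right_cancel₀ (HType.prod_invSqrt_pos _).ne' e

/-- The type of the channels from the remaining inputs to the remaining outputs. -/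
abbrev restType (x : HType) (H : List (Sys × Sys)) : HType :=
  .arrow (.elem (restIns x H)) (.elem (restOuts x H))

theorem scale_restType (hx : x.NoRepeat) (h : Feedback x H) : (restType x H).scale = x.scale := by
  rw [HType.scale, HType.scale, HType.scale, ← h.scale_mul_prod_restIns hx,
    mul_div_cancel_right₀ _ (HType.prod_invSqrt_pos _).ne']

theorem detSupp_restType (b : Set Sys) :
    (restType x H).DetSupp b ↔ ∃ B ∈ restOuts x H, B ∈ b := by
  have : (HType.elem (restIns x H)).DetSupp b ∨ ∀ A ∈ (HType.elem (restIns x H)).ele, A ∉ b := by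
    simp only [HType.DetSupp, HType.ele]
    by_cases hb : ∃ A ∈ restIns x H, A ∈ b
    · exact Or.inl hb
    · push Not at hb
      exact Or.inr hb
  exact ⟨fun hd => hd this, fun hd _ => hd⟩

/-- The type of the maps which accept arbitrary channels in the place of the contractions. -/
abbrev target (x : HType) (H : List (Sys × Sys)) : HType :=
  .arrow (HType.wires H) (restType x H)

theorem disjoint_wires_rest (h : Feedback x H) :
    Disjoint (HType.wires H).ele (restType x H).ele := by
  rw [Finset.disjoint_left]
  intro i hi hr
  obtain ⟨p, hp, hi⟩ := (HType.mem_ele_wires H i).mp hi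
  obtain ⟨n1, n2⟩ := (h.mem_rest_iff.mp hr).2 p hp
  exact hi.elim n1 n2

theorem noRepeat_target (h : Feedback x H) : (target x H).NoRepeat :=
  ⟨HType.noRepeat_wires h.ne h.disj, ⟨trivial, trivial, disjoint_rest⟩, h.disjoint_wires_rest⟩

theorem ele_target (h : Feedback x H) : x.ele = (target x H).ele := by
  ext i
  rw [HType.ele, Finset.mem_union, HType.mem_ele_wires]
  change _ ↔ _ ∨ i ∈ restIns x H ∪ restOuts x H
  rw [h.mem_rest_iff]
  constructor
  · intro hi
    by_cases hu : Untouched H i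
    · exact Or.inr ⟨hi, hu⟩
    · unfold Untouched at hu
      push Not at hu
      obtain ⟨p, hp, hne⟩ := hu
      refine Or.inl ⟨p, hp, ?_⟩
      by_cases h1 : i = p.1
      · exact Or.inl h1
      · exact Or.inr (hne h1)
  · rintro (⟨p, hp, rfl | rfl⟩ | hi)
    · exact x.ins_subset (h.pair p hp).1
    · exact x.outs_subset (h.pair p hp).2.1
    · exact hi.1

/-- The combinatorial form of the admissibility of a contraction: no allowed component survives the
contraction as a component without outputs. -/
def Causal (x : HType) (H : List (Sys × Sys)) : Prop :=
  ∀ b : Finset Sys, x.DetSupp b → (∀ p ∈ H, p.1 ∈ b ↔ p.2 ∈ b) → ∃ B ∈ restOuts x H, B ∈ b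

/-- For supports matched on all pairs the two conditions agree; the remaining supports are reduced
to matched ones by discarding inputs. -/
theorem included_target_iff (hx : x.NoRepeat) (h : Feedback x H) :
    x.Included (target x H) ↔ Causal x H := by
  have hs : x.scale = (target x H).scale := by
    rw [target, HType.scale, h.scale_restType hx,
      HType.scale_wires fun p hp => (h.pair p hp).2.2, div_one]
  have hD : ∀ b : Finset Sys, (target x H).DetSupp b ↔
      ((∀ p ∈ H, p.2 ∈ b → p.1 ∈ b) → ∃ B ∈ restOuts x H, B ∈ b) := fun b =>
    imp_congr (HType.nullOrDetSupp_wires H b) (detSupp_restType b)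
  rw [included_iff hx h.noRepeat_target h.ele_target hs]
  simp only [hD]
  constructor
  · exact fun hall b hb hm => hall b hb fun p hp => (hm p hp).mpr
  · intro hc b hb hw
    -- Drop each contracted input whose partner output is absent from `b`. Only inputs are removed,
    -- so the support stays allowed, and it is now matched.
    let b' : Finset Sys := b.filter fun i => ∀ p ∈ H, i = p.1 → p.2 ∈ b
    have hout : ∀ A ∈ x.outs, A ∈ b → A ∈ b' := fun A hA hAb =>
      Finset.mem_filter.mpr ⟨hAb, fun p hp he =>
        (Finset.disjoint_left.mp x.disjoint_ins_outs (h.pair p hp).1 (he ▸ hA)).elim⟩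
    have hb' : x.DetSupp b' := hb.mono hx
      (fun A _ hA => (Finset.mem_filter.mp hA).1) hout
    obtain ⟨B, hB, hBb⟩ := hc b' hb' fun p hp => by
      constructor
      · intro h1
        exact hout _ (h.pair p hp).2.1 ((Finset.mem_filter.mp h1).2 p hp rfl)
      · intro h2
        have h2b := (Finset.mem_filter.mp h2).1
        refine Finset.mem_filter.mpr ⟨hw p hp h2b, fun q hq he => ?_⟩
        rwa [← h.eq_of_fst_eq hp hq he]
    exact ⟨B, hB, (Finset.mem_filter.mp hBb).1⟩

/-- If a label is trivial on the remaining outputs, causality forbids every matched label that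
extends it. At most the identity term survives, which gives the affine conditions of a channel. -/
theorem admissible_of_causal (hx : x.NoRepeat) (h : Feedback x H) (hc : Causal x H) :
    MultiContractionAdmissible H x := by
  intro R hR
  obtain ⟨hRs, hRp, hRa⟩ := (mem_detMaps_iff hx R).mp hR
  have hw : Wiring R.sys H := hRs ▸ h.wiring
  have hz : (restType x H).NoRepeat := ⟨trivial, trivial, disjoint_rest⟩
  refine ⟨restType x H, hz, (mem_detMaps_iff hz _).mpr ⟨?_, multiContract_posSemidef hRp, ?_⟩⟩
  · ext i
    rw [mem_sys_multiContract hw, hRs]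
    exact h.mem_rest_iff.symm
  · intro f hf
    rw [hat_multiContract hw, h.scale_restType hx]
    refine multiContract_ev_eq (Q := hat R) hw f _ fun g hg hm => ?_
    have hgD : ¬x.DetSupp (supp g) := by
      classical
      intro hd
      let b : Finset Sys := x.ele.filter fun i => g i ≠ 0
      have hb : ∀ i ∈ x.ele, i ∈ supp g ↔ i ∈ (b : Set Sys) := fun i hi => by
        simp [b, hi, mem_supp]
      have hmb : ∀ p ∈ H, p.1 ∈ b ↔ p.2 ∈ b := fun p hp => by
        have hp' := h.wiring.pair p hp
        simp only [b, Finset.mem_filter, hp'.1, hp'.2.1, true_and]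
        exact not_congr (hm p hp)
      obtain ⟨B, hB, hBb⟩ := hc b ((HType.detSupp_congr hb).mp hd) hmb
      refine hf ((detSupp_restType _).mpr ⟨B, hB, ?_⟩)
      have hu := (h.mem_rest_iff.mp (Finset.mem_union_right _ hB)).2
      rw [mem_supp, ← hg B hu]
      exact (Finset.mem_filter.mp hBb).2
    rw [hRa g hgD]
    have e : (∀ i ∈ x.ele, g i = 0) ↔
        (∀ p ∈ H, g p.1 = 0) ∧ ∀ i ∈ (restType x H).ele, f i = 0 := by
      constructor
      · refine fun h0 => ⟨fun p hp => h0 _ (h.wiring.pair p hp).1, fun i hi => ?_⟩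
        obtain ⟨hi, hu⟩ := h.mem_rest_iff.mp hi
        rw [← hg i hu, h0 i hi]
      · rintro ⟨h1, h2⟩ i hi
        rw [h.ele_target, HType.ele, Finset.mem_union, HType.mem_ele_wires] at hi
        rcases hi with ⟨p, hp, rfl | rfl⟩ | hi
        · exact h1 p hp
        · exact (hm p hp).mp (h1 p hp)
        · rw [hg i (h.mem_rest_iff.mp hi).2, h2 i hi]
    rw [if_congr e rfl rfl, ite_and]

theorem prod_invSqrt_anti {S T : Finset Sys} (hST : S ⊆ T) :
    ∏ i ∈ T, invSqrt i.dim ≤ ∏ i ∈ S, invSqrt i.dim := by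
  rw [← Finset.prod_sdiff hST]
  refine mul_le_of_le_one_left (HType.prod_invSqrt_pos S).le ?_
  exact Finset.prod_le_one (fun i _ => (invSqrt_pos (Nat.succ_pos _)).le)
    fun i _ => (invSqrt_lt_one (Nat.le_add_left 2 _)).le

/-- Turning inputs into outputs lowers the component along the identity. -/
theorem scale_le_of_outs {z : HType} (hx : x.NoRepeat) (h : Feedback x H) (hz : z.NoRepeat)
    (he : z.ele = restIns x H ∪ restOuts x H) (ho : restOuts x H ⊆ z.outs) :
    z.scale ≤ x.scale ∧ (∀ B ∈ z.outs, B ∉ restOuts x H → z.scale < x.scale) := by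
  have hi : z.ins ⊆ restIns x H := by
    intro i hi
    have h1 := z.ins_subset hi
    rw [he, Finset.mem_union] at h1
    exact h1.resolve_right fun h2 => Finset.disjoint_left.mp z.disjoint_ins_outs hi (ho h2)
  have ez := HType.scale_mul_prod_ins hz
  have ex := h.scale_mul_prod_restIns hx
  have p1 := HType.prod_invSqrt_pos z.ins
  have p2 := HType.prod_invSqrt_pos (restIns x H)
  have l1 := prod_invSqrt_anti hi
  have l2 := prod_invSqrt_anti ho
  rw [← ez, ← ex] at l2
  have zs := z.scale_pos
  have xs := x.scale_pos
  constructor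
  · have : z.scale * ∏ i ∈ z.ins, invSqrt i.dim ≤ x.scale * ∏ i ∈ z.ins, invSqrt i.dim :=
      l2.trans (mul_le_mul_of_nonneg_left l1 xs.le)
    exact le_of_mul_le_mul_right this p1
  · intro B hB hBn
    have l3 : ∏ i ∈ z.outs, invSqrt i.dim < ∏ i ∈ restOuts x H, invSqrt i.dim := by
      refine (prod_invSqrt_anti (Finset.insert_subset hB ho)).trans_lt ?_
      rw [Finset.prod_insert hBn]
      exact mul_lt_of_lt_one_left (HType.prod_invSqrt_pos _)
        (invSqrt_lt_one (Nat.le_add_left 2 _))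
    rw [← ez, ← ex] at l3
    exact lt_of_mul_lt_mul_right (l3.trans_le (mul_le_mul_of_nonneg_left l1 xs.le)) p1.le

theorem matched_labelOf {b : Finset Sys} {p : Sys × Sys} (hb : p.1 ∈ b ↔ p.2 ∈ b) :
    Matched (labelOf b) p := by
  unfold Matched labelOf
  by_cases h1 : p.1 ∈ b
  · simp [h1, hb.mp h1]
  · simp [h1, mt hb.mpr h1]

/-- The generic map is contracted and its type `z`, of which nothing is known beforehand, is
constrained by comparing outputs and scales; nonnegative components make every single term a lower
bound. -/
theorem causal_of_admissible (hx : x.NoRepeat) (h : Feedback x H)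
    (ha : MultiContractionAdmissible H x) : Causal x H := by
  classical
  -- it suffices to consider supports inside the systems of `x`
  suffices hmain : ∀ b : Finset Sys, b ⊆ x.ele → x.DetSupp b → (∀ p ∈ H, p.1 ∈ b ↔ p.2 ∈ b) →
      ∃ B ∈ restOuts x H, B ∈ b by
    intro b hb hm
    obtain ⟨B, hB, hBb⟩ := hmain (x.ele ∩ b) Finset.inter_subset_left
      ((HType.detSupp_congr fun A hA => by simp [hA]).mp hb) fun p hp => by
        have hp' := h.wiring.pair p hp
        simp [hp'.1, hp'.2.1, hm p hp]
    exact ⟨B, hB, (Finset.mem_inter.mp hBb).2⟩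
  intro b hbx hb hm
  by_contra! hno
  obtain ⟨ε, hε, R, hR, hev⟩ := exists_isDet_full x
  obtain ⟨z, hz, hCz⟩ := ha R ((mem_detMaps_iff hx R).mpr hR)
  obtain ⟨hzs, -, hza⟩ := (mem_detMaps_iff hz _).mp hCz
  have hw : Wiring R.sys H := hR.1 ▸ h.wiring
  have hez : z.ele = restIns x H ∪ restOuts x H := by
    rw [← hzs]
    ext i
    rw [mem_sys_multiContract hw, hR.1]
    exact h.mem_rest_iff.symm
  rw [IsAffine, hat_multiContract hw] at hza
  have hεC : (0 : ℂ) < ε := by exact_mod_cast hε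
  have hcC : (0 : ℂ) < x.scale := by exact_mod_cast x.scale_pos
  have hnn : ∀ g, 0 ≤ (hat R).ev g := by
    intro g
    rw [hev]
    refine add_nonneg ?_ ?_
    · split_ifs
      exacts [hcC.le, le_rfl]
    · split_ifs
      exacts [hεC.le, le_rfl]
  have hlow : ∀ d : Finset Sys, x.DetSupp d → (ε : ℂ) ≤ (hat R).ev (labelOf d) := by
    intro d hd
    rw [hev, supp_labelOf, if_pos hd]
    refine le_add_of_nonneg_left ?_
    split_ifs
    exacts [hcC.le, le_rfl]
  have hzero : (x.scale : ℂ) ≤ (hat R).ev 0 := by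
    rw [hev, if_pos fun _ _ => by rfl]
    refine le_add_of_nonneg_right ?_
    split_ifs
    exacts [hεC.le, le_rfl]
  have hsum := fun f G => sum_le_multiContract_ev (Q := hat R) hw hnn f G
  -- a component which survives the contraction is allowed in `z`
  have hallow : ∀ d : Finset Sys, x.DetSupp d → (∀ p ∈ H, p.1 ∈ d ↔ p.2 ∈ d) →
      ∀ e : Finset Sys, (∀ i, Untouched H i → (i ∈ d ↔ i ∈ e)) → (∃ i ∈ z.ele, i ∈ e) →
      z.DetSupp e := by
    intro d hd hdm e hde ⟨i, hi, hie⟩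
    by_contra hze
    have h1 := hsum (labelOf e) {labelOf d} (by
      intro g hg
      rw [Finset.mem_singleton.mp hg]
      refine ⟨fun i hi => ?_, fun p hp => matched_labelOf (hdm p hp)⟩
      simp only [labelOf, hde i hi])
    rw [Finset.sum_singleton, hza _ (by rwa [supp_labelOf]),
      if_neg fun h0 => labelOf_eq_zero.mp (h0 i hi) hie] at h1
    exact absurd ((hlow d hd).trans h1) hεC.not_ge
  have hout : restOuts x H ⊆ z.outs := by
    intro B hB
    have hBx : B ∈ x.outs := (Finset.mem_sdiff.mp hB).1
    have hBr := Finset.mem_union_right (restIns x H) hB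
    have hBu := (h.mem_rest_iff.mp hBr).2
    -- Singletons recover the outputs: `{B}` is allowed in `x` and survives the contraction, so it
    -- is allowed in `z`, and an allowed support contains an output.
    have hd : x.DetSupp (({B} : Finset Sys) : Set Sys) :=
      HType.detSupp_of_ins hx ⟨B, x.outs_subset hBx, by simp⟩ fun A hA hAB =>
        Finset.disjoint_left.mp x.disjoint_ins_outs hA (by
          have : A = B := by simpa using hAB
          rwa [this])
    have hzB := hallow {B} hd
      (fun p hp => by
        simp only [Finset.mem_singleton, (hBu p hp).1.symm, (hBu p hp).2.symm])
      {B} (fun _ _ => Iff.rfl) ⟨B, hez ▸ hBr, Finset.mem_singleton_self B⟩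
    obtain ⟨C, hC, hCB⟩ := hzB.exists_outs hz
    have : C = B := by simpa using hCB
    rwa [← this]
  obtain ⟨hle, hlt⟩ := scale_le_of_outs hx h hz hez hout
  have hz0 : ¬z.DetSupp (supp 0) := fun hd => by
    obtain ⟨A, -, hA⟩ := hd.exists_mem
    exact hA rfl
  have hza0 := hza 0 hz0
  rw [if_pos fun _ _ => by rfl] at hza0
  have hm0 : ∀ p ∈ H, Matched 0 p := fun p _ => ⟨rfl, rfl⟩
  -- If `b` keeps an uncontracted system, its remainder is allowed in `z` and contains an output of
  -- `z` outside `restOuts x H`. Then `z.scale < x.scale`, although the identity component is at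
  -- least `x.scale`.
  by_cases hbr : ∃ i ∈ b, Untouched H i
  · obtain ⟨i, hib, hiu⟩ := hbr
    let e : Finset Sys := b.filter (Untouched H)
    have hie : i ∈ e := Finset.mem_filter.mpr ⟨hib, hiu⟩
    have hzi : i ∈ z.ele := by
      rw [hez, h.mem_rest_iff]
      exact ⟨hbx hib, hiu⟩
    have hze := hallow b hb hm e (fun j hj => by simp [e, hj]) ⟨i, hzi, hie⟩
    obtain ⟨B, hB, hBe⟩ := hze.exists_outs hz
    have hlt := hlt B hB fun hBr => hno B hBr (Finset.mem_filter.mp hBe).1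
    have h1 := hsum 0 {0} (by
      intro g hg
      rw [Finset.mem_singleton.mp hg]
      exact ⟨fun _ _ => rfl, hm0⟩)
    rw [Finset.sum_singleton, hza0] at h1
    have h2 : x.scale ≤ z.scale := by exact_mod_cast hzero.trans h1
    exact absurd h2 hlt.not_ge
  · push Not at hbr
    -- Here `b` is contracted entirely, so it contributes to the identity component beside the zero
    -- label, giving `x.scale + ε ≤ z.scale`.
    have hne : (0 : PairConf) ≠ labelOf b := by
      intro h0
      obtain ⟨A, -, hA⟩ := hb.exists_mem
      exact labelOf_eq_zero.mp (congrFun h0 A).symm hA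
    have h1 := hsum 0 {0, labelOf b} (by
      intro g hg
      rcases Finset.mem_insert.mp hg with rfl | hg
      · exact ⟨fun _ _ => rfl, hm0⟩
      · rw [Finset.mem_singleton.mp hg]
        exact ⟨fun i hi => labelOf_eq_zero.mpr fun hib => hbr i hib hi,
          fun p hp => matched_labelOf (hm p hp)⟩)
    rw [Finset.sum_pair hne, hza0] at h1
    have h2 : x.scale + ε ≤ z.scale := by
      exact_mod_cast (add_le_add hzero (hlow b hb)).trans h1
    linarith

theorem multiContractionAdmissible_iff (hx : x.NoRepeat) (h : Feedback x H) :
    MultiContractionAdmissible H x ↔ x.Included (target x H) :=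
  ⟨fun ha => (h.included_target_iff hx).mpr (h.causal_of_admissible hx ha),
    fun hi => h.admissible_of_causal hx ((h.included_target_iff hx).mp hi)⟩

end Feedback

end HOQT

end

open HOQT
theorem mainTheorem8 (x : HType) (hx : x.NoRepeat) :
    (∀ H : List (Sys × Sys),
      (∀ p ∈ H, p.1 ∈ x.ins ∧ p.2 ∈ x.outs ∧ p.1.dim = p.2.dim) →
      H.Pairwise (fun p q => Disjoint ({p.1, p.2} : Finset Sys) {q.1, q.2}) →
      (MultiContractionAdmissible H x ↔
        x.Included
          (.arrow
            (.bigTensor (H.map fun p => .arrow (.elem {p.2}) (.elem {p.1})))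
            (.arrow
              (.elem (x.ins \ (H.map Prod.fst).toFinset))
              (.elem (x.outs \ (H.map Prod.snd).toFinset)))))) ∧
    (∀ A ∈ x.ins, ∀ B ∈ x.outs, A.dim = B.dim →
      (ContractionAdmissible A B x ↔
        x.Included
          (.arrow
            (.arrow (.elem {B}) (.elem {A}))
            (.arrow (.elem (x.ins \ {A})) (.elem (x.outs \ {B})))))) := by
  refine ⟨fun H hp hH => Feedback.multiContractionAdmissible_iff hx ⟨hp, hH⟩,
    fun A hA B hB hd => ?_⟩
  -- Part (2) is the case of one pair: on a singleton list the tensor product, the contraction and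
  -- the sets of removed systems reduce by definition to the stated ones.
  have h : Feedback x [(A, B)] := ⟨List.forall_mem_singleton.mpr ⟨hA, hB, hd⟩, List.pairwise_singleton _ _⟩
  exact h.multiContractionAdmissible_iff hx
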